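/- **Setting.** For every $n\in\mathbb N$ let $m=m(n)$, $k=k(n)$, $r=r(n)$, $l=l(n)$, $N=N(n)$ be natural numbers with $0\le l\le r\le k$. As $n\to\infty$ let $m\to\infty$, $(\log n)/m\to0$ and $k/m\to\gamma$ with $\gamma<1$. On a common probability space, let $A=A^{(n)}\in\mathbb R^{m\times n}$ be a random matrix with i.i.d. entries of law $\mathcal N(0,1/m)$ and columns $a_1,\dots,a_n$, and let $W=W^{(n)}\in\mathbb R^{m\times N}$ be a random noise matrix of arbitrary law, independent of $A$ (nothing is assumed about the joint law for different $n$). Let $X=X^{(n)}\in\mathbb R^{n\times N}$ be deterministic with $|\operatorname{supp}X|=k$, where $\operatorname{supp}X$ is the set of indices of its nonzero rows, and put $Y=AX+W$. Let $\tilde S=Y\,V(Y)\in\mathbb R^{m\times r}$, where $V$ is an arbitrary measurable map from $\mathbb R^{m\times N}$ to $\mathbb R^{N\times r}$ (for example, the one given by a singular value decomposition of $Y$, so that $\tilde S$ is the usual rank-$r$ signal subspace estimate); thus $\tilde S=A\tilde X+\tilde W$ with $\tilde X=XV(Y)$, $\tilde W=WV(Y)$. Let $S\in\mathbb R^{m\times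 r}$ be any (random) matrix with $R(S)=R(A\tilde X)$, where $R$ denotes the column space, and let $\Delta=\|S-\tilde S\|$ (spectral norm). Let $I=I_{k-r+l}\subset\operatorname{supp}X$ be a deterministic index set with $|I|=k-r+l$. For an index set $T$ and a singular value decomposition of $[A_T\ \tilde S]$ with singular values in decreasing order, let $\tilde U_1(T)$ consist of the left singular vectors belonging to the $k$ largest singular values, and define the score of $j$ by $\|P^{\perp}_{R(\tilde U_1(T))}a_j\|^2$. The generalized MUSIC steps started at $I$ are either 1. *all at once*: select $r-l$ indices outside $I$ with the smallest scores computed with $T=I$; or 2. *one by one*: starting with $T=I$, repeat $r-l$ times: add to $T$ the index $j\notin T$ with the smallest score computed with the current $T$ (the smallest such index in case of a tie). They *recover the support* if, for every admissible choice of singular value decompositions and (in 1) of minimizing indices, the indices selected in 1 are exactly those of $\operatorname{supp}X\setminus I$, and the final set $T$ in 2 is $\operatorname{supp}X$. **Theorem.** Let $\mathcal S_n$ be the event that $$\frac{\sigma_k([A_{I_{k-r+l}}\ S])}{\Delta}>1+\frac1{1-\gamma}$$ (where $\sigma_k$ is the $k$-th largest singular value, and for $\Delta=0$ the condition is read as $\sigma_k>0$).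 Then in the large system limit the generalized MUSIC steps find the remaining $r-l$ support indices whenever $\mathcal S_n$ holds, in both of the following senses: * $\mathbb P\big(\mathcal S_n\text{ holds and the generalized MUSIC steps fail to recover the support}\big)\to0$ as $n\to\infty$; * almost surely, for all sufficiently large $n$: if $\mathcal S_n$ holds, then the generalized MUSIC steps recover the support. -/

import Mathlib

open Filter Topology MeasureTheory ProbabilityTheory
open scoped NNReal

noncomputable section

/-- The product (= Borel) σ-algebra on real matrices. -/
instance matrixMeasurableSpace {m n : Type*} : MeasurableSpace (Matrix m n ℝ) :=
  inferInstanceAs (MeasurableSpace (m → n → ℝ))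

/-- `A` is a random `m × n` matrix with i.i.d. entries of law `N(0, 1/m)`. -/
structure IsGaussianSensing {Ω : Type*} [MeasurableSpace Ω] {m n : ℕ}
    (A : Ω → Matrix (Fin m) (Fin n) ℝ) (P : Measure Ω) : Prop where
  measurable : Measurable A
  law : ∀ i j, HasLaw (fun ω => A ω i j) (gaussianReal 0 ((m : ℝ≥0)⁻¹)) P
  indep : iIndepFun (fun (ij : Fin m × Fin n) (ω : Ω) => A ω ij.1 ij.2) P

/-- `supp X`: the set of indices of the nonzero rows of `X`. -/
def rowSupport {n N : ℕ} (X : Matrix (Fin n) (Fin N) ℝ) : Finset (Fin n) :=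
  open Classical in Finset.univ.filter fun i => X i ≠ 0

/-- The augmented matrix `[A_I  S]`. -/
def augmented {m n r : ℕ} (A : Matrix (Fin m) (Fin n) ℝ) (I : Finset (Fin n))
    (S : Matrix (Fin m) (Fin r) ℝ) : Matrix (Fin m) (I ⊕ Fin r) ℝ :=
  Matrix.fromCols (A.submatrix id (fun i : I => (i : Fin n))) S

/-- The spectral norm of `M`: the operator norm for the Euclidean norms. -/
def spectralNorm2 {m r : ℕ} (M : Matrix (Fin m) (Fin r) ℝ) : ℝ :=
  ‖LinearMap.toContinuousLinearMap (Matrix.toEuclideanLin M)‖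

/-- The `k`-th largest singular value of `M`, for `k ≥ 1`
(Mathlib's sequence of singular values starts at index `0`). -/
def kthSingularValue {m : ℕ} {ι : Type*} [Fintype ι] [DecidableEq ι]
    (M : Matrix (Fin m) ι ℝ) (k : ℕ) : ℝ :=
  (Matrix.toEuclideanLin M).singularValues (k - 1)

/-- `U` is the span of the left singular vectors belonging to the `k` largest singular values,
in some singular value decomposition `M = ∑ᵢ sᵢ uᵢ vᵢᵀ` with `s₀ ≥ s₁ ≥ ⋯ ≥ 0`.
(`U` is determined by `M` as soon as the `k`-th singular value exceeds the next one.) -/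
def IsLeadingLeftSingularSpace {m : ℕ} {ι : Type*} [Fintype ι] (M : Matrix (Fin m) ι ℝ) (k : ℕ)
    (U : Submodule ℝ (EuclideanSpace ℝ (Fin m))) : Prop :=
  ∃ (p : ℕ) (u : Fin p → EuclideanSpace ℝ (Fin m)) (s : Fin p → ℝ)
    (v : Fin p → EuclideanSpace ℝ ι),
    k ≤ p ∧ Orthonormal ℝ u ∧ Orthonormal ℝ v ∧ Antitone s ∧ (∀ i, 0 ≤ s i) ∧
    M = ∑ i, s i • Matrix.vecMulVec (u i).ofLp (v i).ofLp ∧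
    U = Submodule.span ℝ (u '' {i | (i : ℕ) < k})

/-- The MUSIC score `‖P_U^⊥ a_j‖²` of the index `j`, where `a_j` is the `j`-th column of `A`. -/
def musicScore {m n : ℕ} (A : Matrix (Fin m) (Fin n) ℝ)
    (U : Submodule ℝ (EuclideanSpace ℝ (Fin m))) (j : Fin n) : ℝ :=
  ‖Uᗮ.starProjection (WithLp.toLp 2 (fun i => A i j))‖ ^ 2

/-- `J` is a possible result of the generalized MUSIC step which selects, all at once, `p` indices
outside `I` with the smallest scores with respect to the leading `k`-dimensional left singular
space of `[A_I  S]`. -/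
def IsMusicSelection {m n r : ℕ} (A : Matrix (Fin m) (Fin n) ℝ) (S : Matrix (Fin m) (Fin r) ℝ)
    (k : ℕ) (I : Finset (Fin n)) (p : ℕ) (J : Finset (Fin n)) : Prop :=
  ∃ U, IsLeadingLeftSingularSpace (augmented A I S) k U ∧
    Disjoint I J ∧ J.card = p ∧
    ∀ j ∈ J, ∀ i, i ∉ I → i ∉ J → musicScore A U j ≤ musicScore A U i

/-- `T` is a possible result of `q` successive generalized MUSIC steps started at `I`: each step
computes the leading `k`-dimensional left singular space of `[A_T  S]` for the current index set
`T` and adds to `T` the index outside `T` with the smallest score (the first one, if several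
indices attain the minimum). -/
inductive SeqMusicRun {m n r : ℕ} (A : Matrix (Fin m) (Fin n) ℝ) (S : Matrix (Fin m) (Fin r) ℝ)
    (k : ℕ) (I : Finset (Fin n)) : ℕ → Finset (Fin n) → Prop
  | start : SeqMusicRun A S k I 0 I
  | step (q : ℕ) (T : Finset (Fin n)) (U : Submodule ℝ (EuclideanSpace ℝ (Fin m))) (j : Fin n) :
      SeqMusicRun A S k I q T →
      IsLeadingLeftSingularSpace (augmented A T S) k U →
      j ∉ T →
      (∀ i, i ∉ T → musicScore A U j ≤ musicScore A U i) →
      (∀ i, i ∉ T → musicScore A U i = musicScore A U j → j ≤ i) →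
      SeqMusicRun A S k I (q + 1) (insert j T)

/-- Starting from the known part `I` of the support `supp`, the generalized MUSIC steps find the
remaining `p` support indices, both when they are selected all at once and when they are found
one by one. -/
def MusicRecovers {m n r : ℕ} (A : Matrix (Fin m) (Fin n) ℝ) (S : Matrix (Fin m) (Fin r) ℝ)
    (k : ℕ) (I : Finset (Fin n)) (p : ℕ) (supp : Finset (Fin n)) : Prop :=
  (∀ J, IsMusicSelection A S k I p J → J = supp \ I) ∧
  (∀ T, SeqMusicRun A S k I p T → T = supp)

/-- `σ_k([A_I  S]) / ‖S - St‖ > 1 + 1 / (1 - γ)`, where a positive number divided by `0`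
counts as `+∞` (so that the noiseless case `S = St` is included). -/
def SnrCondition {m n r : ℕ} (A : Matrix (Fin m) (Fin n) ℝ) (S St : Matrix (Fin m) (Fin r) ℝ)
    (k : ℕ) (I : Finset (Fin n)) (γ : ℝ) : Prop :=
  (1 + 1 / (1 - γ)) * spectralNorm2 (S - St) < kthSingularValue (augmented A I S) k

end

/-! The proof separates the scores. Put `d = min ((1 - γ)²) (1 / 2)` and let `U₀` be the span of the
support columns. Support indices score at most about `d`, all other indices at least about `1 - γ`,
and `d < 1 - γ`.

The first bound is deterministic. For `I ⊆ T ⊆ supp X` consider the form `‖[A_T St]ᵀ x‖²`. On `U₀`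
it is at least `(σ_k - Δ)² ‖x‖²`, since passing from `S` to `St` costs at most `Δ`. On `U₀ᗮ` it is
at most `Δ² ‖x‖²`, since `A_Tᵀ` and `Sᵀ` vanish there. The condition forces `Δ / (σ_k - Δ) ≤ 1 - γ`,
and a `sin Θ` theorem (`IsDominantSubspace.norm_sq_starProjection_orthogonal_le`) gives `‖P_{Uᗮ}
a_j‖² ≤ d ‖a_j‖²` for each leading singular space `U` and each support column. The cap `1 / 2` holds
for any positive gap; it is what keeps `d < 1 - γ` at `γ = 0`. The lengths `‖a_j‖²` are close to 1
by Gaussian concentration.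

The second bound is probabilistic. If `U` is independent of an outside column `a_j`, then `m ‖P_{Uᗮ}
a_j‖²` is chi-squared with at least `m - k` degrees of freedom. In the sequential algorithm,
however, the current set `T` is chosen by comparing all columns. The remedy is `OracleRun`, the same
algorithm restricted to support indices: it depends only on the support columns and the noise, hence
is independent of `a_j`, and it visits one set per step, so the union bound has at most `n · p`
terms, with `p` the number of steps. As long as scores are separated, the true run coincides with it
(`SnrCondition.musicRecovers`). Conditioning needs a measurable version of the projection onto `U`;
the gap makes `U` unique whenever the condition holds, and `exists_measurable_dominantProjection`
then suffices.

Both failure bounds are exponential in `m`, and `log n = o(m)` brings their sum below `1 / n²`. This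
gives convergence to zero, and by the first Borel–Cantelli lemma also the almost sure statement,
whatever the joint law over `n`. -/

/-! ### Perturbation theory of dominant subspaces -/

section DominantSubspace

open Module Submodule
open scoped InnerProductSpace

variable {E F : Type*} [NormedAddCommGroup E] [InnerProductSpace ℝ E]
  [NormedAddCommGroup F] [InnerProductSpace ℝ F]

/-- `U` reduces the quadratic form `x ↦ ‖L x‖²`, whose Rayleigh quotient is at least as large
on `U` as on `Uᗮ`. -/
structure IsDominantSubspace (L : E →ₗ[ℝ] F) (U : Submodule ℝ E) : Prop where
  inner_eq_zero : ∀ u ∈ U, ∀ w ∈ Uᗮ, ⟪L u, L w⟫_ℝ = 0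
  le : ∀ u ∈ U, ∀ w ∈ Uᗮ, ‖L w‖ ^ 2 * ‖u‖ ^ 2 ≤ ‖L u‖ ^ 2 * ‖w‖ ^ 2

lemma norm_sq_map_smul_add {L : E →ₗ[ℝ] F} {x y : E} (h : ⟪L x, L y⟫_ℝ = 0) (c : ℝ) :
    ‖L (c • x + y)‖ ^ 2 = c ^ 2 * ‖L x‖ ^ 2 + ‖L y‖ ^ 2 := by
  rw [map_add, map_smul, norm_add_sq_real, real_inner_smul_left, h, norm_smul, mul_pow]
  simp

lemma norm_sq_smul_add {x y : E} (h : ⟪x, y⟫_ℝ = 0) (c : ℝ) :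
    ‖c • x + y‖ ^ 2 = c ^ 2 * ‖x‖ ^ 2 + ‖y‖ ^ 2 :=
  norm_sq_map_smul_add (L := LinearMap.id) h c

variable [FiniteDimensional ℝ E]

lemma exists_ne_zero_mem_of_finrank_lt {U V : Submodule ℝ E}
    (h : finrank ℝ E < finrank ℝ U + finrank ℝ V) : ∃ x ∈ U, x ∈ V ∧ x ≠ 0 := by
  by_contra! hc
  have : Disjoint U V := Submodule.disjoint_def.2 fun x hx hy => hc x hx hy
  have := Submodule.finrank_add_finrank_le_of_disjoint this
  omega

lemma finrank_span_singleton_sup {x : E} {V : Submodule ℝ E} (hx : x ≠ 0) (hxV : x ∈ Vᗮ) :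
    finrank ℝ (ℝ ∙ x ⊔ V : Submodule ℝ E) = finrank ℝ V + 1 := by
  have hd : Disjoint (ℝ ∙ x) V := by
    refine (Submodule.orthogonal_disjoint V).symm.mono_left ?_
    simpa [Submodule.span_singleton_le_iff_mem] using hxV
  have := Submodule.finrank_sup_add_finrank_inf_eq (ℝ ∙ x) V
  rw [hd.eq_bot, finrank_bot, finrank_span_singleton hx] at this
  omega

variable {L : E →ₗ[ℝ] F} {U U₀ : Submodule ℝ E} {a b : ℝ}

/-- A dominant subspace inherits a lower Rayleigh bound from any subspace of its dimension. -/
lemma IsDominantSubspace.le_norm_sq (hU : IsDominantSubspace L U)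
    (hfr : finrank ℝ U = finrank ℝ U₀) (ha : ∀ x ∈ U₀, a * ‖x‖ ^ 2 ≤ ‖L x‖ ^ 2)
    {u : E} (hu : u ∈ U) : a * ‖u‖ ^ 2 ≤ ‖L u‖ ^ 2 := by
  rcases eq_or_ne u 0 with rfl | hu0
  · simp
  -- Courant–Fischer count: `U₀` meets `span u ⊔ Uᗮ` nontrivially. On a common vector `c • u + w`,
  -- dominance bounds the Rayleigh quotient of `w` by that of `u`.
  have hdim : finrank ℝ E < finrank ℝ U₀ + finrank ℝ (ℝ ∙ u ⊔ Uᗮ : Submodule ℝ E) := by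
    rw [finrank_span_singleton_sup hu0 (by simpa using hu), ← U.finrank_add_finrank_orthogonal]
    omega
  obtain ⟨x, hx, hxV, hx0⟩ := exists_ne_zero_mem_of_finrank_lt hdim
  obtain ⟨y, hy, w, hw, rfl⟩ := Submodule.mem_sup.1 hxV
  obtain ⟨c, rfl⟩ := Submodule.mem_span_singleton.1 hy
  have h1 := ha _ hx
  have h2 := hU.le u hu w hw
  have hn := norm_sq_smul_add (hw u hu) c
  rw [norm_sq_map_smul_add (hU.inner_eq_zero u hu w hw) c] at h1
  have hpos : 0 < ‖c • u + w‖ ^ 2 := by positivity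
  have hu2 : 0 ≤ ‖u‖ ^ 2 := by positivity
  refine le_of_mul_le_mul_right ?_ hpos
  have h3 := mul_le_mul_of_nonneg_right h1 hu2
  rw [hn] at h3 ⊢
  linarith

/-- The orthogonal complement of a dominant subspace inherits an upper Rayleigh bound. -/
lemma IsDominantSubspace.norm_sq_le (hU : IsDominantSubspace L U)
    (hfr : finrank ℝ U = finrank ℝ U₀) (hb : ∀ x ∈ U₀ᗮ, ‖L x‖ ^ 2 ≤ b * ‖x‖ ^ 2)
    {w : E} (hw : w ∈ Uᗮ) : ‖L w‖ ^ 2 ≤ b * ‖w‖ ^ 2 := by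
  rcases eq_or_ne w 0 with rfl | hw0
  · simp
  have hdim : finrank ℝ E < finrank ℝ U₀ᗮ + finrank ℝ (ℝ ∙ w ⊔ U : Submodule ℝ E) := by
    rw [finrank_span_singleton_sup hw0 hw, ← U₀.finrank_add_finrank_orthogonal]
    omega
  obtain ⟨x, hx, hxV, hx0⟩ := exists_ne_zero_mem_of_finrank_lt hdim
  obtain ⟨y, hy, u, hu, rfl⟩ := Submodule.mem_sup.1 hxV
  obtain ⟨c, rfl⟩ := Submodule.mem_span_singleton.1 hy
  have h1 := hb _ hx
  have h2 := hU.le u hu w hw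
  have hn := norm_sq_smul_add (by rw [real_inner_comm]; exact hw u hu : ⟪w, u⟫_ℝ = 0) c
  rw [norm_sq_map_smul_add (by rw [real_inner_comm]; exact hU.inner_eq_zero u hu w hw) c] at h1
  have hpos : 0 < ‖c • w + u‖ ^ 2 := by positivity
  have hu2 : 0 ≤ ‖w‖ ^ 2 := by positivity
  refine le_of_mul_le_mul_right ?_ hpos
  have h3 := mul_le_mul_of_nonneg_right h1 hu2
  rw [hn] at h3 ⊢
  linarith

/-- To bound the gap between two subspaces it suffices to treat principal vectors. -/
lemma norm_sq_starProjection_le_of_principal {V : Submodule ℝ E} {κ : ℝ}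
    (h : ∀ x ∈ U₀, ‖x‖ = 1 → ∀ t : ℝ,
      U₀.starProjection (V.starProjection x) = t • x → t ≤ κ)
    {x : E} (hx : x ∈ U₀) : ‖V.starProjection x‖ ^ 2 ≤ κ * ‖x‖ ^ 2 := by
  -- The compression of `P_V` to `U₀` is symmetric with quadratic form `‖P_V x‖²`; its eigenvectors
  -- are the principal vectors.
  let T : U₀ →ₗ[ℝ] U₀ :=
    (U₀.orthogonalProjectionOnto : E →ₗ[ℝ] U₀) ∘ₗ (V.starProjection : E →ₗ[ℝ] E) ∘ₗ U₀.subtype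
  have hTval : ∀ x : U₀, (T x : E) = U₀.starProjection (V.starProjection x) := fun x => rfl
  have key : ∀ x y : U₀, ⟪T x, y⟫_ℝ = ⟪V.starProjection x, V.starProjection y⟫_ℝ := by
    intro x y
    rw [Submodule.coe_inner, hTval, Submodule.inner_starProjection_left_eq_right,
      Submodule.starProjection_eq_self_iff.2 y.2,
      ← Submodule.inner_starProjection_left_eq_right V,
      Submodule.starProjection_eq_self_iff.2 (Submodule.starProjection_apply_mem V _)]
  have hT : T.IsSymmetric := fun x y => by
    rw [key, real_inner_comm, ← key, real_inner_comm]
  let e := hT.eigenvectorBasis rfl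
  have hev : ∀ i, hT.eigenvalues rfl i ≤ κ := by
    intro i
    refine h (e i : E) (e i).2 (e.orthonormal.1 i) _ ?_
    rw [← hTval]
    exact congrArg Subtype.val (hT.apply_eigenvectorBasis rfl i)
  have h1 : ‖V.starProjection x‖ ^ 2 = ⟪T ⟨x, hx⟩, (⟨x, hx⟩ : U₀)⟫_ℝ := by
    rw [key, real_inner_self_eq_norm_sq]
  have h2 : ‖x‖ ^ 2 = ∑ i, ⟪e i, (⟨x, hx⟩ : U₀)⟫_ℝ ^ 2 :=
    (e.sum_sq_inner_right (⟨x, hx⟩ : U₀)).symm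
  rw [h1, ← e.sum_inner_mul_inner, h2, Finset.mul_sum]
  refine Finset.sum_le_sum fun i _ => ?_
  have h3 : ⟪T ⟨x, hx⟩, e i⟫_ℝ = hT.eigenvalues rfl i * ⟪e i, (⟨x, hx⟩ : U₀)⟫_ℝ := by
    rw [hT, hT.apply_eigenvectorBasis, real_inner_comm, RCLike.ofReal_real_eq_id, id,
      real_inner_smul_left]
  rw [h3, mul_assoc, ← sq]
  exact mul_le_mul_of_nonneg_right (hev i) (sq_nonneg _)

/-- A principal vector `x` of `U₀` relative to a dominant subspace `U`, with squared sine `t`: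
the Rayleigh quotients `p`, `q` of the components of `x` in `U` and `Uᗮ`. -/
lemma IsDominantSubspace.principal_bound (hU : IsDominantSubspace L U)
    (hfr : finrank ℝ U = finrank ℝ U₀) (ha : ∀ x ∈ U₀, a * ‖x‖ ^ 2 ≤ ‖L x‖ ^ 2)
    (hb : ∀ x ∈ U₀ᗮ, ‖L x‖ ^ 2 ≤ b * ‖x‖ ^ 2) (hb0 : 0 ≤ b) (hab : b < a)
    {x : E} (hx : x ∈ U₀) (hx1 : ‖x‖ = 1) {t : ℝ}
    (ht : U₀.starProjection (Uᗮ.starProjection x) = t • x) : a * t ≤ b ∧ t ≤ 1 / 2 := by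
  set u := U.starProjection x with hu
  set w := Uᗮ.starProjection x with hw
  have huU : u ∈ U := U.starProjection_apply_mem x
  have hwU : w ∈ Uᗮ := Uᗮ.starProjection_apply_mem x
  have hxuw : x = u + w := (U.starProjection_add_starProjection_orthogonal x).symm
  have huw : ⟪u, w⟫_ℝ = 0 := hwU u huU
  have hLuw := hU.inner_eq_zero u huU w hwU
  have hQx : U₀.starProjection x = x := Submodule.starProjection_eq_self_iff.2 hx
  have hwn : ‖w‖ ^ 2 = t := by
    have h1 : ⟪U₀.starProjection w, x⟫_ℝ = t := by
      rw [ht, real_inner_smul_left, real_inner_self_eq_norm_sq, hx1]; ring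
    rw [Submodule.inner_starProjection_left_eq_right, hQx, hxuw, inner_add_right,
      real_inner_comm, huw, real_inner_self_eq_norm_sq] at h1
    linarith
  have hun : ‖u‖ ^ 2 = 1 - t := by
    have := norm_sq_smul_add huw 1
    rw [one_smul, ← hxuw, hx1] at this
    linarith
  have ht0 : 0 ≤ t := hwn ▸ sq_nonneg _
  have hc0 : 0 ≤ 1 - t := hun ▸ sq_nonneg _
  -- the component of `w` orthogonal to `U₀`
  have hy : (-t) • u + (1 - t) • w ∈ U₀ᗮ := by
    have h1 : (-t) • u + (1 - t) • w = w - U₀.starProjection w := by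
      rw [ht, hxuw]; module
    rw [h1]
    exact Submodule.sub_starProjection_mem_orthogonal w
  have hLy := hb _ hy
  have e1 : ⟪u, (1 - t) • w⟫_ℝ = 0 := by rw [real_inner_smul_right, huw, mul_zero]
  have e2 : ⟪L u, L ((1 - t) • w)⟫_ℝ = 0 := by
    rw [map_smul, real_inner_smul_right, hLuw, mul_zero]
  rw [norm_sq_smul_add e1, norm_sq_map_smul_add e2, map_smul, norm_smul, norm_smul, mul_pow,
    mul_pow, Real.norm_eq_abs, sq_abs, hwn, hun] at hLy
  have hLx := ha _ hx
  have e3 := norm_sq_map_smul_add hLuw 1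
  rw [one_smul, ← hxuw] at e3
  rw [e3, hx1] at hLx
  have hp := hU.le_norm_sq hfr ha huU
  have hq := hU.norm_sq_le hfr hb hwU
  rw [hun] at hp
  rw [hwn] at hq
  have hLw0 : 0 ≤ ‖L w‖ ^ 2 := sq_nonneg _
  -- For `t = 1` the vector `x` would lie in `Uᗮ`, where the form is at most `b < a`.
  have hlt : t < 1 := by
    by_contra! hge
    have h1 : t = 1 := by linarith
    have hu0 : ‖u‖ ^ 2 = 0 := by rw [hun, h1]; ring
    have : u = 0 := by simpa using hu0
    rw [this, map_zero, norm_zero] at hLx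
    rw [h1] at hq
    linarith
  have hc : 0 < 1 - t := by linarith
  generalize ‖L u‖ ^ 2 = p at *
  generalize ‖L w‖ ^ 2 = q at *
  -- dividing `hLy` by `t (1 - t)`
  rcases eq_or_lt_of_le ht0 with rfl | htpos
  · constructor <;> linarith
  constructor
  · have h1 : t ^ 2 * (a * (1 - t)) ≤ b * t * (1 - t) := by
      have := mul_le_mul_of_nonneg_left hp (sq_nonneg t)
      have h2 := mul_nonneg (sq_nonneg (1 - t)) hLw0
      nlinarith
    have h2 : 0 < t * (1 - t) := by positivity
    refine le_of_mul_le_mul_right ?_ h2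
    linarith
  -- Here `hLy` and `p + q ≥ a > b` give `(2t - 1)(t p - (1 - t) q) < 0`, while `t p ≥ (1 - t) q`
  -- because `U` carries the larger Rayleigh quotients.
  · by_contra! hgt
    have h2 : 0 < t * (1 - t) := by positivity
    have h3 := mul_le_mul_of_nonneg_left hLx h2.le
    have h4 : (0:ℝ) < 2 * t - 1 := by linarith
    have h5 : q * (1 - t) ≤ p * t := by nlinarith
    nlinarith

/-- A `sin Θ` bound: if the form `‖L x‖²` is at least `a` on `U₀` and at most `b < a` on `U₀ᗮ`,
then a dominant subspace of the same dimension is close to `U₀`. -/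
lemma IsDominantSubspace.norm_sq_starProjection_orthogonal_le (hU : IsDominantSubspace L U)
    (hfr : finrank ℝ U = finrank ℝ U₀) (ha : ∀ x ∈ U₀, a * ‖x‖ ^ 2 ≤ ‖L x‖ ^ 2)
    (hb : ∀ x ∈ U₀ᗮ, ‖L x‖ ^ 2 ≤ b * ‖x‖ ^ 2) (hb0 : 0 ≤ b) (hab : b < a)
    {x : E} (hx : x ∈ U₀) : ‖Uᗮ.starProjection x‖ ^ 2 ≤ min (b / a) (1 / 2) * ‖x‖ ^ 2 := by
  refine norm_sq_starProjection_le_of_principal (fun x hx hx1 t ht => ?_) hx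
  obtain ⟨h1, h2⟩ := hU.principal_bound hfr ha hb hb0 hab hx hx1 ht
  refine le_min ?_ h2
  rw [le_div_iff₀ (by linarith)]
  linarith

/-- Dominant subspaces are unique in the presence of a gap. -/
lemma IsDominantSubspace.eq_of_gap {U' : Submodule ℝ E} (hU : IsDominantSubspace L U)
    (hU' : IsDominantSubspace L U')
    (hfr : finrank ℝ U = finrank ℝ U₀) (hfr' : finrank ℝ U' = finrank ℝ U₀)
    (ha : ∀ x ∈ U₀, a * ‖x‖ ^ 2 ≤ ‖L x‖ ^ 2)
    (hb : ∀ x ∈ U₀ᗮ, ‖L x‖ ^ 2 ≤ b * ‖x‖ ^ 2) (hab : b < a) : U' = U := by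
  have key : ∀ x ∈ U', ‖Uᗮ.starProjection x‖ ^ 2 ≤ 0 * ‖x‖ ^ 2 := by
    refine fun x hx => norm_sq_starProjection_le_of_principal (fun x hx hx1 t ht => ?_) hx
    set u := U.starProjection x with hu
    set w := Uᗮ.starProjection x with hw
    have huU : u ∈ U := U.starProjection_apply_mem x
    have hwU : w ∈ Uᗮ := Uᗮ.starProjection_apply_mem x
    have hxuw : x = u + w := (U.starProjection_add_starProjection_orthogonal x).symm
    have hQx : U'.starProjection x = x := Submodule.starProjection_eq_self_iff.2 hx
    have hwn : ‖w‖ ^ 2 = t := by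
      have h1 : ⟪U'.starProjection w, x⟫_ℝ = t := by
        rw [ht, real_inner_smul_left, real_inner_self_eq_norm_sq, hx1]; ring
      rw [Submodule.inner_starProjection_left_eq_right, hQx, hxuw, inner_add_right,
        real_inner_comm, hwU u huU, real_inner_self_eq_norm_sq] at h1
      linarith
    -- `⟪L w, L x⟫` is computed twice: it is `‖L w‖² ≤ b t` because `U` reduces the form, and `t ‖L
    -- x‖² ≥ a t` because `U'` does. Hence `t = 0`.
    have h1 : ⟪L w, L x⟫_ℝ = ‖L w‖ ^ 2 := by
      rw [hxuw, map_add, inner_add_right, real_inner_comm, hU.inner_eq_zero u huU w hwU,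
        real_inner_self_eq_norm_sq, zero_add]
    have h2 : ⟪L w, L x⟫_ℝ = t * ‖L x‖ ^ 2 := by
      have h3 : w = t • x + (w - U'.starProjection w) := by rw [ht]; abel
      rw [h3, map_add, map_smul, inner_add_left, real_inner_smul_left, real_inner_self_eq_norm_sq,
        real_inner_comm, hU'.inner_eq_zero x hx _ (Submodule.sub_starProjection_mem_orthogonal w),
        add_zero]
    have h4 := hU.norm_sq_le hfr hb hwU
    have h5 := hU'.le_norm_sq hfr' ha hx
    rw [hwn, ← h1, h2] at h4
    rw [hx1] at h5
    have ht0 : 0 ≤ t := hwn ▸ sq_nonneg _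
    by_contra! hpos
    nlinarith
  refine Submodule.eq_of_le_of_finrank_eq (fun x hx => ?_) (hfr'.trans hfr.symm)
  have h1 : Uᗮ.starProjection x = 0 := by
    have := key x hx
    rw [zero_mul] at this
    simpa using le_antisymm this (sq_nonneg _)
  rw [← U.starProjection_add_starProjection_orthogonal x, h1, add_zero]
  exact U.starProjection_apply_mem x

/-- On the range of `T`, the adjoint expands by at least the last nonzero singular value. -/
lemma LinearMap.singularValues_mul_le_norm_adjoint {T : E →ₗ[ℝ] F} [FiniteDimensional ℝ F]
    {k : ℕ} (hk : finrank ℝ (LinearMap.range T) ≤ k + 1) {x : F} (hx : x ∈ LinearMap.range T) :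
    T.singularValues k ^ 2 * ‖x‖ ^ 2 ≤ ‖LinearMap.adjoint T x‖ ^ 2 := by
  obtain ⟨z, rfl⟩ := hx
  have hT := T.isSymmetric_adjoint_comp_self
  let e := hT.eigenvectorBasis rfl
  have hsv : ∀ i : Fin (finrank ℝ E), hT.eigenvalues rfl i = T.singularValues i ^ 2 :=
    fun i => (T.sq_singularValues_fin rfl i).symm
  have h0 : ∀ i, ⟪e i, LinearMap.adjoint T (T z)⟫_ℝ = T.singularValues i ^ 2 * ⟪e i, z⟫_ℝ := by
    intro i
    have := hT (e i) z
    rw [hT.apply_eigenvectorBasis] at this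
    simpa [real_inner_smul_left, hsv] using this.symm
  have h1 : ‖T z‖ ^ 2 = ∑ i : Fin (finrank ℝ E), T.singularValues i ^ 2 * ⟪e i, z⟫_ℝ ^ 2 := by
    rw [← real_inner_self_eq_norm_sq, ← LinearMap.adjoint_inner_right, ← e.sum_inner_mul_inner]
    refine Finset.sum_congr rfl fun i _ => ?_
    rw [h0, real_inner_comm]; ring
  have h2 : ‖LinearMap.adjoint T (T z)‖ ^ 2
      = ∑ i : Fin (finrank ℝ E), T.singularValues i ^ 2 * (T.singularValues i ^ 2 * ⟪e i, z⟫_ℝ ^ 2) := by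
    rw [← e.sum_sq_inner_right]
    refine Finset.sum_congr rfl fun i _ => ?_
    rw [h0]; ring
  rw [h1, h2, Finset.mul_sum]
  refine Finset.sum_le_sum fun i _ => ?_
  -- Indices start at 0, so rank at most `k + 1` makes every singular value with index above `k`
  -- vanish.
  rcases le_or_gt (i : ℕ) k with hi | hi
  · have := T.singularValues_antitone hi
    have h3 := T.singularValues_nonneg k
    gcongr
  · have : T.singularValues i = 0 := by
      rw [LinearMap.singularValues_eq_zero_iff_le_finrank_range]; omega
    simp [this]

end DominantSubspace

/-! ### Leading singular spaces and the deterministic score bound -/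

section LeadingSingularSpace

open Module Submodule
open scoped InnerProductSpace

variable {m n r : ℕ}

lemma toEuclideanLin_sum_vecMulVec_transpose {ι : Type*} [Fintype ι] {p : ℕ}
    (u : Fin p → EuclideanSpace ℝ (Fin m)) (s : Fin p → ℝ) (v : Fin p → EuclideanSpace ℝ ι)
    (x : EuclideanSpace ℝ (Fin m)) :
    Matrix.toEuclideanLin (∑ i, s i • Matrix.vecMulVec (u i).ofLp (v i).ofLp).transpose x =
      ∑ i, (s i * ⟪u i, x⟫_ℝ) • v i := by
  ext j
  simp only [Matrix.toLpLin_apply, Matrix.mulVec, dotProduct, Matrix.transpose_apply,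
    Matrix.sum_apply, Matrix.smul_apply, Matrix.vecMulVec_apply, smul_eq_mul, WithLp.ofLp_sum,
    WithLp.ofLp_smul, Finset.sum_apply, Pi.smul_apply, PiLp.inner_apply, RCLike.inner_apply,
    conj_trivial]
  simp_rw [Finset.sum_mul, Finset.mul_sum, Finset.sum_mul]
  rw [Finset.sum_comm]
  refine Finset.sum_congr rfl fun i _ => Finset.sum_congr rfl fun l _ => ?_
  ring

/-- A leading left singular space of `M` is a dominant subspace for `x ↦ ‖Mᵀ x‖²`. -/
lemma IsLeadingLeftSingularSpace.finrank_eq_and_isDominantSubspace {ι : Type*} [Fintype ι]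
    {M : Matrix (Fin m) ι ℝ} {k : ℕ} {U : Submodule ℝ (EuclideanSpace ℝ (Fin m))}
    (h : IsLeadingLeftSingularSpace M k U) :
    finrank ℝ U = k ∧ IsDominantSubspace (Matrix.toEuclideanLin M.transpose) U := by
  obtain ⟨p, u, s, v, hkp, hu, hv, hs, hs0, rfl, rfl⟩ := h
  set U := Submodule.span ℝ (u '' {i | (i : ℕ) < k}) with hU
  have hinner : ∀ x y, ⟪Matrix.toEuclideanLin
      (∑ i, s i • Matrix.vecMulVec (u i).ofLp (v i).ofLp).transpose x, Matrix.toEuclideanLin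
      (∑ i, s i • Matrix.vecMulVec (u i).ofLp (v i).ofLp).transpose y⟫_ℝ
      = ∑ i, s i ^ 2 * (⟪u i, x⟫_ℝ * ⟪u i, y⟫_ℝ) := by
    intro x y
    rw [toEuclideanLin_sum_vecMulVec_transpose, toEuclideanLin_sum_vecMulVec_transpose,
      hv.inner_sum]
    refine Finset.sum_congr rfl fun i _ => ?_
    rw [conj_trivial]; ring
  have hmem : ∀ i : Fin p, (i : ℕ) < k → u i ∈ U := fun i hi =>
    Submodule.subset_span ⟨i, hi, rfl⟩
  have horth : ∀ w ∈ Uᗮ, ∀ i : Fin p, (i : ℕ) < k → ⟪u i, w⟫_ℝ = 0 :=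
    fun w hw i hi => hw _ (hmem i hi)
  have hzero : ∀ x ∈ U, ∀ i : Fin p, ¬ (i : ℕ) < k → ⟪u i, x⟫_ℝ = 0 := by
    intro x hx i hi
    induction hx using Submodule.span_induction with
    | mem x hx =>
      obtain ⟨j, hj, rfl⟩ := hx
      exact hu.2 fun hij => hi (hij ▸ hj)
    | zero => simp
    | add x y _ _ h1 h2 => rw [inner_add_right, h1, h2, add_zero]
    | smul c x _ h1 => rw [real_inner_smul_right, h1, mul_zero]
  have hexp : ∀ x ∈ U, ∑ i, ⟪u i, x⟫_ℝ • u i = x := by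
    intro x hx
    induction hx using Submodule.span_induction with
    | mem x hx =>
      obtain ⟨j, hj, rfl⟩ := hx
      rw [Finset.sum_eq_single j]
      · rw [real_inner_self_eq_norm_sq, hu.1]; simp
      · intro i _ hij; rw [hu.2 hij, zero_smul]
      · simp
    | zero => simp
    | add x y _ _ h1 h2 => simp_rw [inner_add_right, add_smul, Finset.sum_add_distrib, h1, h2]
    | smul c x _ h1 =>
      simp_rw [real_inner_smul_right, mul_smul, ← Finset.smul_sum, h1]
  have hnorm : ∀ x ∈ U, ‖x‖ ^ 2 = ∑ i, ⟪u i, x⟫_ℝ ^ 2 := by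
    intro x hx
    have h1 := hu.inner_sum (fun i => ⟪u i, x⟫_ℝ) (fun i => ⟪u i, x⟫_ℝ) Finset.univ
    rw [hexp x hx, real_inner_self_eq_norm_sq] at h1
    rw [h1]
    exact Finset.sum_congr rfl fun i _ => by rw [conj_trivial, sq]
  refine ⟨?_, ⟨fun x hx w hw => ?_, fun x hx w hw => ?_⟩⟩
  · have h1 : u '' {i | (i : ℕ) < k} = Set.range (fun i : Fin k => u (Fin.castLE hkp i)) := by
      ext y
      constructor
      · rintro ⟨i, hi, rfl⟩
        exact ⟨⟨i, hi⟩, rfl⟩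
      · rintro ⟨i, rfl⟩
        exact ⟨_, i.2, rfl⟩
    rw [hU, h1, finrank_span_eq_card]
    · simp
    · exact (hu.comp _ (Fin.castLE_injective hkp)).linearIndependent
  · rw [hinner]
    refine Finset.sum_eq_zero fun i _ => ?_
    by_cases hi : (i : ℕ) < k
    · rw [horth w hw i hi]; ring
    · rw [hzero x hx i hi]; ring
  · rcases Nat.eq_zero_or_pos k with rfl | hk
    · have : x = 0 := by simpa [hU] using hx
      simp [this]
    -- The `k`-th singular value is the threshold: the form is at least `s l ^ 2` on `U`, and at
    -- most that on `Uᗮ` by Bessel's inequality.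
    let l : Fin p := ⟨k - 1, by omega⟩
    have h1 : s l ^ 2 * ‖x‖ ^ 2 ≤ ‖Matrix.toEuclideanLin
        (∑ i, s i • Matrix.vecMulVec (u i).ofLp (v i).ofLp).transpose x‖ ^ 2 := by
      rw [hnorm x hx, ← real_inner_self_eq_norm_sq, hinner, Finset.mul_sum]
      refine Finset.sum_le_sum fun i _ => ?_
      rw [← sq]
      by_cases hi : (i : ℕ) < k
      · have h2 : s l ≤ s i := hs (Fin.le_def.2 (by simp [l]; omega))
        have h3 := hs0 l
        gcongr
      · rw [hzero x hx i hi]; simp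
    have h2 : ‖Matrix.toEuclideanLin
        (∑ i, s i • Matrix.vecMulVec (u i).ofLp (v i).ofLp).transpose w‖ ^ 2
        ≤ s l ^ 2 * ‖w‖ ^ 2 := by
      have hbes := hu.sum_inner_products_le (x := w) (s := Finset.univ)
      refine le_trans ?_ (mul_le_mul_of_nonneg_left hbes (sq_nonneg _))
      rw [← real_inner_self_eq_norm_sq, hinner, Finset.mul_sum]
      refine Finset.sum_le_sum fun i _ => ?_
      rw [← sq, Real.norm_eq_abs, sq_abs]
      by_cases hi : (i : ℕ) < k
      · rw [horth w hw i hi]; simp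
      · have h2 : s i ≤ s l := hs (Fin.le_def.2 (by simp [l]; omega))
        have h3 := hs0 i
        gcongr
    calc _ ≤ s l ^ 2 * ‖w‖ ^ 2 * ‖x‖ ^ 2 := mul_le_mul_of_nonneg_right h2 (sq_nonneg _)
      _ = s l ^ 2 * ‖x‖ ^ 2 * ‖w‖ ^ 2 := by ring
      _ ≤ _ := mul_le_mul_of_nonneg_right h1 (sq_nonneg _)

/-- The `j`-th column of `A` as a Euclidean vector. -/
noncomputable def euclideanCol (A : Matrix (Fin m) (Fin n) ℝ) (j : Fin n) :
    EuclideanSpace ℝ (Fin m) :=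
  WithLp.toLp 2 (fun i => A i j)

/-- The span of the columns of `A` with indices in `T`. -/
noncomputable def columnSpan (A : Matrix (Fin m) (Fin n) ℝ) (T : Finset (Fin n)) :
    Submodule ℝ (EuclideanSpace ℝ (Fin m)) :=
  Submodule.span ℝ (euclideanCol A '' T)

lemma finrank_columnSpan_le (A : Matrix (Fin m) (Fin n) ℝ) (T : Finset (Fin n)) :
    finrank ℝ (columnSpan A T) ≤ T.card := by
  classical
  rw [columnSpan, ← Finset.coe_image]
  exact (finrank_span_finset_le_card _).trans Finset.card_image_le

lemma euclideanCol_mem_columnSpan (A : Matrix (Fin m) (Fin n) ℝ) {T : Finset (Fin n)} {j : Fin n}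
    (hj : j ∈ T) : euclideanCol A j ∈ columnSpan A T :=
  Submodule.subset_span ⟨j, hj, rfl⟩

lemma toLp_mulVec_eq_sum (A : Matrix (Fin m) (Fin n) ℝ) (c : Fin n → ℝ) :
    WithLp.toLp 2 (A.mulVec c) = ∑ j, c j • euclideanCol A j := by
  ext i
  simp [euclideanCol, Matrix.mulVec, dotProduct, mul_comm]

lemma toEuclideanLin_augmented_apply (A : Matrix (Fin m) (Fin n) ℝ) (T : Finset (Fin n))
    (S : Matrix (Fin m) (Fin r) ℝ) (z : EuclideanSpace ℝ (T ⊕ Fin r)) :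
    Matrix.toEuclideanLin (augmented A T S) z =
      ∑ j : T, z (Sum.inl j) • euclideanCol A j +
        WithLp.toLp 2 (S.mulVec fun j => z (Sum.inr j)) := by
  ext i
  simp [augmented, euclideanCol, Matrix.toLpLin_apply, Matrix.mulVec, dotProduct, mul_comm]

lemma norm_sq_toEuclideanLin_augmented_transpose (A : Matrix (Fin m) (Fin n) ℝ)
    (T : Finset (Fin n)) (S : Matrix (Fin m) (Fin r) ℝ) (x : EuclideanSpace ℝ (Fin m)) :
    ‖Matrix.toEuclideanLin (augmented A T S).transpose x‖ ^ 2 =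
      ∑ j ∈ T, ⟪euclideanCol A j, x⟫_ℝ ^ 2 + ‖Matrix.toEuclideanLin S.transpose x‖ ^ 2 := by
  rw [EuclideanSpace.norm_sq_eq, EuclideanSpace.norm_sq_eq, Fintype.sum_sum_type,
    ← Finset.sum_coe_sort T]
  congr 1
  refine Finset.sum_congr rfl fun j _ => ?_
  simp [augmented, euclideanCol, Matrix.toLpLin_apply, Matrix.mulVec, dotProduct,
    PiLp.inner_apply, mul_comm]

lemma toEuclideanLin_transpose_eq_adjoint {ι : Type*} [Fintype ι] [DecidableEq ι]
    (M : Matrix (Fin m) ι ℝ) :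
    Matrix.toEuclideanLin M.transpose = LinearMap.adjoint (Matrix.toEuclideanLin M) := by
  rw [← Matrix.toEuclideanLin_conjTranspose_eq_adjoint, Matrix.conjTranspose_eq_transpose_of_trivial]

lemma norm_toEuclideanLin_transpose_le (M : Matrix (Fin m) (Fin r) ℝ)
    (x : EuclideanSpace ℝ (Fin m)) :
    ‖Matrix.toEuclideanLin M.transpose x‖ ≤ spectralNorm2 M * ‖x‖ := by
  rcases eq_or_lt_of_le (norm_nonneg (Matrix.toEuclideanLin M.transpose x)) with h | h
  · rw [← h]
    exact mul_nonneg (norm_nonneg _) (norm_nonneg _)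
  refine le_of_mul_le_mul_right ?_ h
  rw [← sq, ← real_inner_self_eq_norm_sq]
  nth_rw 1 [toEuclideanLin_transpose_eq_adjoint]
  rw [LinearMap.adjoint_inner_left]
  refine (real_inner_le_norm _ _).trans ?_
  have := (LinearMap.toContinuousLinearMap (Matrix.toEuclideanLin M)).le_opNorm
    (Matrix.toEuclideanLin M.transpose x)
  rw [LinearMap.coe_toContinuousLinearMap'] at this
  calc _ ≤ ‖x‖ * (spectralNorm2 M * ‖Matrix.toEuclideanLin M.transpose x‖) := by
        gcongr; exact this
    _ = _ := by ring

lemma spectralNorm2_nonneg (M : Matrix (Fin m) (Fin r) ℝ) : 0 ≤ spectralNorm2 M := norm_nonneg _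

lemma range_augmented_le (A : Matrix (Fin m) (Fin n) ℝ) {I T : Finset (Fin n)} (hIT : I ⊆ T)
    {S : Matrix (Fin m) (Fin r) ℝ} (hS : ∀ c, WithLp.toLp 2 (S.mulVec c) ∈ columnSpan A T) :
    LinearMap.range (Matrix.toEuclideanLin (augmented A I S)) ≤ columnSpan A T := by
  rintro _ ⟨z, rfl⟩
  rw [toEuclideanLin_augmented_apply]
  refine Submodule.add_mem _ (Submodule.sum_mem _ fun j _ => Submodule.smul_mem _ _ ?_) (hS _)
  exact euclideanCol_mem_columnSpan A (hIT j.2)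

/-- Weyl-type estimate: `√(α² + β²) ≥ t ≥ δ` and `β' ≥ β - δ` imply `√(α² + β'²) ≥ t - δ`. -/
lemma sub_sq_le_add_sq_of_sq_le {α β β' δ t : ℝ} (hα : 0 ≤ α) (hβ : 0 ≤ β)
    (hδ : 0 ≤ δ) (hδt : δ ≤ t) (ht : t ^ 2 ≤ α + β ^ 2) (h : β - δ ≤ β') :
    (t - δ) ^ 2 ≤ α + β' ^ 2 := by
  have hR0 := Real.sqrt_nonneg (α + β ^ 2)
  have hR : Real.sqrt (α + β ^ 2) ^ 2 = α + β ^ 2 := Real.sq_sqrt (by positivity)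
  have htR : t ≤ Real.sqrt (α + β ^ 2) := Real.le_sqrt_of_sq_le ht
  generalize Real.sqrt (α + β ^ 2) = R at *
  have h1 : (t - δ) ^ 2 ≤ (R - δ) ^ 2 := by
    have : 0 ≤ t - δ := by linarith
    gcongr
  refine h1.trans ?_
  -- If `β ≥ δ`, use `(β - δ)² = β² - 2βδ + δ²` with `β ≤ R`. Otherwise `α ≥ R² - δ²` is already at
  -- least `(R - δ)²`, since `R ≥ δ`.
  rcases le_total δ β with hc | hc
  · have hβR : β ≤ R := by nlinarith
    have h2 : (β - δ) ^ 2 ≤ β' ^ 2 := by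
      have : 0 ≤ β - δ := by linarith
      gcongr
    nlinarith
  · have : β ^ 2 ≤ δ ^ 2 := by gcongr
    nlinarith [sq_nonneg β']

variable {A : Matrix (Fin m) (Fin n) ℝ} {S St : Matrix (Fin m) (Fin r) ℝ} {k : ℕ}
  {I supp : Finset (Fin n)} {γ : ℝ}

/-- Under the signal-to-noise condition the span of the columns in the support has full dimension
and is separated from its complement by the form `x ↦ ‖[A_T St]ᵀ x‖²`. -/
lemma SnrCondition.exists_gap (h : SnrCondition A S St k I γ) (hk : 0 < k) (hγ : γ < 1) (h0γ : 0 ≤ γ)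
    (hI : I ⊆ supp) (hcard : supp.card = k)
    (hS : ∀ c, WithLp.toLp 2 (S.mulVec c) ∈ columnSpan A supp) :
    finrank ℝ (columnSpan A supp) = k ∧ ∃ a b : ℝ, 0 ≤ b ∧ b < a ∧ b / a ≤ (1 - γ) ^ 2 ∧
      ∀ T, I ⊆ T → T ⊆ supp →
        (∀ x ∈ columnSpan A supp,
          a * ‖x‖ ^ 2 ≤ ‖Matrix.toEuclideanLin (augmented A T St).transpose x‖ ^ 2) ∧
        (∀ x ∈ (columnSpan A supp)ᗮ,
          ‖Matrix.toEuclideanLin (augmented A T St).transpose x‖ ^ 2 ≤ b * ‖x‖ ^ 2) := by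
  unfold SnrCondition kthSingularValue at h
  set σ := (Matrix.toEuclideanLin (augmented A I S)).singularValues (k - 1) with hσ
  set Δ := spectralNorm2 (S - St) with hΔ
  have hΔ0 : 0 ≤ Δ := spectralNorm2_nonneg _
  have hγ0 : 0 < 1 - γ := by linarith
  have hσ1 : Δ + Δ / (1 - γ) < σ := by
    calc _ = (1 + 1 / (1 - γ)) * Δ := by ring
      _ < σ := h
  have hΔγ : 0 ≤ Δ / (1 - γ) := by positivity
  have hσ0 : 0 < σ := by linarith
  have hle := range_augmented_le A hI hS
  -- A positive `k`-th singular value (index `k - 1`) gives rank at least `k`; the range lies in the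
  -- column span, of dimension at most `k`, so both coincide.
  have hrk : k - 1 < finrank ℝ (LinearMap.range (Matrix.toEuclideanLin (augmented A I S))) :=
    (LinearMap.singularValues_pos_iff_lt_finrank_range _).1 hσ0
  have hle2 := Submodule.finrank_mono hle
  have hle3 := finrank_columnSpan_le A supp
  have hfr : finrank ℝ (columnSpan A supp) = k := by omega
  have hrange : LinearMap.range (Matrix.toEuclideanLin (augmented A I S)) = columnSpan A supp :=
    Submodule.eq_of_le_of_finrank_eq hle (by omega)
  refine ⟨hfr, (σ - Δ) ^ 2, Δ ^ 2, sq_nonneg _, ?_, ?_, fun T hIT hT => ⟨fun x hx => ?_,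
    fun x hx => ?_⟩⟩
  -- Since `γ ≥ 0`, the threshold is at least `2Δ`, which is what makes `a = (σ - Δ)²` exceed `b =
  -- Δ²`.
  · have h1 : Δ ≤ Δ / (1 - γ) := by
      rw [le_div_iff₀ hγ0]
      nlinarith
    have h2 : Δ < σ - Δ := by linarith
    gcongr
  · rw [← div_pow]
    have h1 : Δ / (σ - Δ) ≤ 1 - γ := by
      rw [div_le_iff₀ (by linarith)]
      have : Δ = (1 - γ) * (Δ / (1 - γ)) := by field_simp
      nlinarith
    have h2 : 0 ≤ Δ / (σ - Δ) := div_nonneg hΔ0 (by linarith)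
    gcongr
  · have h1 : σ ^ 2 * ‖x‖ ^ 2 ≤ ‖Matrix.toEuclideanLin (augmented A I S).transpose x‖ ^ 2 := by
      rw [toEuclideanLin_transpose_eq_adjoint]
      exact LinearMap.singularValues_mul_le_norm_adjoint (by omega) (hrange ▸ hx)
    rw [norm_sq_toEuclideanLin_augmented_transpose] at h1 ⊢
    have h2 : ∑ j ∈ I, ⟪euclideanCol A j, x⟫_ℝ ^ 2 ≤ ∑ j ∈ T, ⟪euclideanCol A j, x⟫_ℝ ^ 2 :=
      Finset.sum_le_sum_of_subset_of_nonneg hIT fun _ _ _ => sq_nonneg _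
    have h3 := norm_toEuclideanLin_transpose_le (S - St) x
    have h4 : Matrix.toEuclideanLin (S - St).transpose x
        = Matrix.toEuclideanLin S.transpose x - Matrix.toEuclideanLin St.transpose x := by
      rw [Matrix.transpose_sub, map_sub, LinearMap.sub_apply]
    rw [h4] at h3
    have h5 := norm_sub_norm_le (Matrix.toEuclideanLin S.transpose x)
      (Matrix.toEuclideanLin St.transpose x)
    rw [← mul_pow, sub_mul]
    refine sub_sq_le_add_sq_of_sq_le (Finset.sum_nonneg fun _ _ => sq_nonneg _)
      (norm_nonneg (Matrix.toEuclideanLin S.transpose x)) (by positivity)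
      (mul_le_mul_of_nonneg_right (by linarith) (norm_nonneg _)) ?_ (by linarith)
    rw [mul_pow]; linarith
  · rw [norm_sq_toEuclideanLin_augmented_transpose, ← mul_pow]
    have h1 : ∑ j ∈ T, ⟪euclideanCol A j, x⟫_ℝ ^ 2 = 0 := by
      refine Finset.sum_eq_zero fun j hj => ?_
      rw [hx _ (euclideanCol_mem_columnSpan A (hT hj))]; simp
    have h2 : Matrix.toEuclideanLin S.transpose x = 0 := by
      rw [← norm_eq_zero, ← sq_eq_zero_iff, ← real_inner_self_eq_norm_sq]
      nth_rw 1 [toEuclideanLin_transpose_eq_adjoint]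
      rw [LinearMap.adjoint_inner_left, real_inner_comm, Matrix.toLpLin_apply]
      exact hx _ (hS _)
    have h3 := norm_toEuclideanLin_transpose_le (S - St) x
    rw [Matrix.transpose_sub, map_sub, LinearMap.sub_apply, h2, zero_sub, norm_neg] at h3
    rw [h1, zero_add]
    gcongr

/-- The constant by which the scores of the support indices are damped. -/
noncomputable def dampingFactor (γ : ℝ) : ℝ := min ((1 - γ) ^ 2) (1 / 2)

lemma SnrCondition.musicScore_le (h : SnrCondition A S St k I γ) (hk : 0 < k) (hγ : γ < 1) (h0γ : 0 ≤ γ)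
    (hI : I ⊆ supp) (hcard : supp.card = k)
    (hS : ∀ c, WithLp.toLp 2 (S.mulVec c) ∈ columnSpan A supp)
    {T : Finset (Fin n)} (hIT : I ⊆ T) (hT : T ⊆ supp)
    {U : Submodule ℝ (EuclideanSpace ℝ (Fin m))} (hUk : finrank ℝ U = k)
    (hU : IsDominantSubspace (Matrix.toEuclideanLin (augmented A T St).transpose) U)
    {j : Fin n} (hj : j ∈ supp) :
    musicScore A U j ≤ dampingFactor γ * ‖euclideanCol A j‖ ^ 2 := by
  obtain ⟨hfr, a, b, hb0, hab, hκ, hT'⟩ := h.exists_gap hk hγ h0γ hI hcard hS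
  refine (hU.norm_sq_starProjection_orthogonal_le (hUk.trans hfr.symm) (hT' T hIT hT).1
    (hT' T hIT hT).2 hb0 hab (euclideanCol_mem_columnSpan A hj)).trans ?_
  unfold dampingFactor
  gcongr

/-- This uniqueness removes the ambiguity in the choice of singular value decomposition, and lets a
measurable selection stand in for it. -/
lemma SnrCondition.eq_of_isDominantSubspace (h : SnrCondition A S St k I γ) (hk : 0 < k)
    (hγ : γ < 1) (h0γ : 0 ≤ γ) (hI : I ⊆ supp) (hcard : supp.card = k)
    (hS : ∀ c, WithLp.toLp 2 (S.mulVec c) ∈ columnSpan A supp)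
    {T : Finset (Fin n)} (hIT : I ⊆ T) (hT : T ⊆ supp)
    {U U' : Submodule ℝ (EuclideanSpace ℝ (Fin m))} (hUk : finrank ℝ U = k)
    (hU : IsDominantSubspace (Matrix.toEuclideanLin (augmented A T St).transpose) U)
    (hUk' : finrank ℝ U' = k)
    (hU' : IsDominantSubspace (Matrix.toEuclideanLin (augmented A T St).transpose) U') :
    U' = U := by
  obtain ⟨hfr, a, b, hb0, hab, hκ, hT'⟩ := h.exists_gap hk hγ h0γ hI hcard hS
  exact hU.eq_of_gap hU' (hUk.trans hfr.symm) (hUk'.trans hfr.symm) (hT' T hIT hT).1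
    (hT' T hIT hT).2 hab

/-- Columns of `A` outside the support meet zero rows of `X`, so the noiseless signal space lies in
`U₀`. -/
lemma toLp_mulVec_mem_columnSpan_rowSupport {N : ℕ} (X : Matrix (Fin n) (Fin N) ℝ)
    (V : Matrix (Fin N) (Fin r) ℝ)
    (hS : LinearMap.range S.mulVecLin = LinearMap.range (A * (X * V)).mulVecLin)
    (c : Fin r → ℝ) : WithLp.toLp 2 (S.mulVec c) ∈ columnSpan A (rowSupport X) := by
  have h1 : S.mulVec c ∈ LinearMap.range (A * (X * V)).mulVecLin :=
    hS ▸ LinearMap.mem_range_self S.mulVecLin c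
  obtain ⟨d, hd⟩ := h1
  rw [← hd, Matrix.mulVecLin_apply, ← Matrix.mulVec_mulVec, toLp_mulVec_eq_sum]
  refine Submodule.sum_mem _ fun j _ => ?_
  by_cases hj : j ∈ rowSupport X
  · exact Submodule.smul_mem _ _ (euclideanCol_mem_columnSpan A hj)
  · have h2 : X j = 0 := by simpa [rowSupport] using hj
    have h3 : (X * V).mulVec d j = 0 := by
      rw [← Matrix.mulVec_mulVec]
      simp [Matrix.mulVec, h2]
    rw [h3, zero_smul]
    exact Submodule.zero_mem _

end LeadingSingularSpace

/-! ### Measurable selection from a closed relation -/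

section MeasurableSelection

/-- A closed relation with compact fibres has a measurable selection on the set where it is
single-valued. -/
theorem exists_measurable_eq_of_unique {X Y : Type*} [TopologicalSpace X] [MeasurableSpace X]
    [BorelSpace X] [MetricSpace Y] [MeasurableSpace Y] [BorelSpace Y] {K : Set Y}
    (hK : IsCompact K) {R : Set (X × Y)} (hR : IsClosed R) {y₀ : Y} (hy₀ : y₀ ∈ K) :
    ∃ φ : X → Y, Measurable φ ∧ (∀ x, φ x ∈ K) ∧
      ∀ x, ∀ y ∈ K, (x, y) ∈ R → (∀ y' ∈ K, (x, y') ∈ R → y' = y) → φ x = y := by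
  classical
  -- Projection along a compact factor is a closed map.
  have hproj : ∀ C : Set Y, IsClosed C → IsClosed {x | ∃ y ∈ K, (x, y) ∈ R ∧ y ∈ C} := by
    intro C hC
    have : CompactSpace K := isCompact_iff_compactSpace.1 hK
    have h1 : IsClosed {p : X × K | (p.1, (p.2 : Y)) ∈ R ∧ (p.2 : Y) ∈ C} :=
      (hR.preimage (by fun_prop)).inter (hC.preimage (by fun_prop))
    convert isClosedMap_fst_of_compactSpace _ h1 using 1
    ext x
    constructor
    · rintro ⟨y, hy, h⟩
      exact ⟨(x, ⟨y, hy⟩), h, rfl⟩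
    · rintro ⟨⟨x', y⟩, h, rfl⟩
      exact ⟨y, y.2, h⟩
  have hpair : ∀ i : ℕ, IsClosed {x | ∃ y ∈ K, ∃ y' ∈ K,
      (x, y) ∈ R ∧ (x, y') ∈ R ∧ 1 / ((i : ℝ) + 1) ≤ dist y y'} := by
    intro i
    have : CompactSpace K := isCompact_iff_compactSpace.1 hK
    have h1 : IsClosed {p : X × (K × K) | (p.1, (p.2.1 : Y)) ∈ R ∧ (p.1, (p.2.2 : Y)) ∈ R ∧
        1 / ((i : ℝ) + 1) ≤ dist (p.2.1 : Y) (p.2.2 : Y)} :=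
      (hR.preimage (by fun_prop)).inter ((hR.preimage (by fun_prop)).inter
        (isClosed_le continuous_const
          ((continuous_subtype_val.comp (continuous_fst.comp continuous_snd)).dist
            (continuous_subtype_val.comp (continuous_snd.comp continuous_snd)))))
    convert isClosedMap_fst_of_compactSpace _ h1 using 1
    ext x
    constructor
    · rintro ⟨y, hy, y', hy', h⟩
      exact ⟨(x, ⟨y, hy⟩, ⟨y', hy'⟩), h, rfl⟩
    · rintro ⟨⟨x', y, y'⟩, h, rfl⟩
      exact ⟨y, y.2, y', y'.2, h⟩
  -- The points with exactly one solution form a closed set minus the countable union of the closed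
  -- sets of points having two solutions at distance at least `1 / (i + 1)`.
  let D : Set X := {x | ∃ y ∈ K, (x, y) ∈ R ∧ ∀ y' ∈ K, (x, y') ∈ R → y' = y}
  have hD : MeasurableSet D := by
    have : D = {x | ∃ y ∈ K, (x, y) ∈ R ∧ y ∈ Set.univ} \ ⋃ i : ℕ, {x | ∃ y ∈ K, ∃ y' ∈ K,
        (x, y) ∈ R ∧ (x, y') ∈ R ∧ 1 / ((i : ℝ) + 1) ≤ dist y y'} := by
      ext x
      simp only [D, Set.mem_ofPred_eq, Set.mem_sdiff, Set.mem_iUnion, Set.mem_univ, and_true]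
      constructor
      · rintro ⟨y, hy, hxy, hun⟩
        refine ⟨⟨y, hy, hxy⟩, ?_⟩
        rintro ⟨i, y₁, hy₁, y₂, hy₂, h1, h2, h3⟩
        rw [hun y₁ hy₁ h1, hun y₂ hy₂ h2, dist_self] at h3
        have : 0 < 1 / ((i : ℝ) + 1) := Nat.one_div_pos_of_nat
        linarith
      · rintro ⟨⟨y, hy, hxy⟩, hn⟩
        refine ⟨y, hy, hxy, fun y' hy' hxy' => ?_⟩
        by_contra hne
        obtain ⟨i, hi⟩ := exists_nat_one_div_lt (dist_pos.2 hne)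
        exact hn ⟨i, y', hy', y, hy, hxy', hxy, hi.le⟩
    rw [this]
    exact (hproj _ isClosed_univ).measurableSet.diff
      (MeasurableSet.iUnion fun i => (hpair i).measurableSet)
  let φ : X → Y := fun x => if h : x ∈ D then h.choose else y₀
  have hφ : ∀ x, ∀ y ∈ K, (x, y) ∈ R → (∀ y' ∈ K, (x, y') ∈ R → y' = y) → φ x = y := by
    intro x y hy hxy hun
    have hx : x ∈ D := ⟨y, hy, hxy, hun⟩
    simp only [φ, dif_pos hx]
    exact hun _ hx.choose_spec.1 hx.choose_spec.2.1
  refine ⟨φ, measurable_of_isClosed fun C hC => ?_, fun x => ?_, hφ⟩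
  · have : φ ⁻¹' C = (D ∩ {x | ∃ y ∈ K, (x, y) ∈ R ∧ y ∈ C}) ∪ (Dᶜ ∩ {_x | y₀ ∈ C}) := by
      ext x
      by_cases hx : x ∈ D
      · obtain ⟨y, hy, hxy, hun⟩ := id hx
        simp only [Set.mem_preimage, hφ x y hy hxy hun, Set.mem_union, Set.mem_inter_iff, hx,
          true_and, Set.mem_compl_iff, not_true, false_and, or_false, Set.mem_ofPred_eq]
        constructor
        · exact fun h => ⟨y, hy, hxy, h⟩
        · rintro ⟨y', hy', h1, h2⟩
          exact hun y' hy' h1 ▸ h2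
      · simp [φ, hx]
    rw [this]
    exact (hD.inter (hproj C hC).measurableSet).union (hD.compl.inter (MeasurableSet.const _))
  · by_cases hx : x ∈ D
    · simp only [φ, dif_pos hx]
      exact hx.choose_spec.1
    · simpa only [φ, dif_neg hx] using hy₀

end MeasurableSelection

/-! ### A measurable projection onto the dominant subspace -/

section LeadingProjection

open Module
open scoped InnerProductSpace

instance matrixBorelSpace {m n : Type*} [Countable m] [Countable n] :
    BorelSpace (Matrix m n ℝ) :=
  inferInstanceAs (BorelSpace (m → n → ℝ))

variable {m : ℕ}

/-- The trace as a continuous functional of an operator. -/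
noncomputable def opTrace (P : EuclideanSpace ℝ (Fin m) →L[ℝ] EuclideanSpace ℝ (Fin m)) : ℝ :=
  LinearMap.trace ℝ (EuclideanSpace ℝ (Fin m)) (P : _ →ₗ[ℝ] _)

lemma continuous_opTrace : Continuous (opTrace (m := m)) :=
  ((LinearMap.trace ℝ (EuclideanSpace ℝ (Fin m))) ∘ₗ
    ContinuousLinearMap.coeLM ℝ).continuous_of_finiteDimensional

lemma opTrace_starProjection (U : Submodule ℝ (EuclideanSpace ℝ (Fin m))) :
    opTrace U.starProjection = finrank ℝ U := by
  have h : LinearMap.IsProj U (U.starProjection : EuclideanSpace ℝ (Fin m) →ₗ[ℝ] _) :=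
    ⟨fun x => U.starProjection_apply_mem x,
      fun x hx => Submodule.starProjection_eq_self_iff.2 hx⟩
  exact h.trace

/-- The trace is only bounded above, so that the zero projection can serve as default value where
the dominant subspace is not unique or does not exist. The bound still leaves `1 - P` with trace at
least `m - k`, as the tail estimate requires. -/
lemma isCompact_setOf_isStarProjection (k : ℝ) :
    IsCompact {P : EuclideanSpace ℝ (Fin m) →L[ℝ] EuclideanSpace ℝ (Fin m) |
      IsStarProjection P ∧ opTrace P ≤ k} := by
  have : ProperSpace (EuclideanSpace ℝ (Fin m) →L[ℝ] EuclideanSpace ℝ (Fin m)) :=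
    FiniteDimensional.proper ℝ _
  refine Metric.isCompact_of_isClosed_isBounded ?_ ?_
  · simp_rw [isStarProjection_iff']
    refine IsClosed.inter (IsClosed.inter ?_ ?_) (isClosed_le continuous_opTrace continuous_const)
    · exact isClosed_eq (by fun_prop) continuous_id
    · exact isClosed_eq (ContinuousLinearMap.adjoint (𝕜 := ℝ) (E := EuclideanSpace ℝ (Fin m))
        (F := EuclideanSpace ℝ (Fin m))).continuous continuous_id
  · refine (Metric.isBounded_closedBall (x := 0) (r := 1)).subset fun P hP => ?_
    simpa using IsStarProjection.norm_le P hP.1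

lemma opTrace_zero : opTrace (m := m) 0 = 0 := by simp [opTrace]

lemma opTrace_one_sub (P : EuclideanSpace ℝ (Fin m) →L[ℝ] EuclideanSpace ℝ (Fin m)) :
    opTrace (1 - P) = m - opTrace P := by
  have h1 : opTrace (1 : EuclideanSpace ℝ (Fin m) →L[ℝ] EuclideanSpace ℝ (Fin m)) = m := by
    have := opTrace_starProjection (⊤ : Submodule ℝ (EuclideanSpace ℝ (Fin m)))
    simpa only [Submodule.starProjection_top', finrank_top, finrank_euclideanSpace_fin] using this
  rw [← h1]
  exact map_sub (LinearMap.trace ℝ (EuclideanSpace ℝ (Fin m))) _ _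

/-- A measurable version of the projection onto the dominant subspace. -/
theorem exists_measurable_dominantProjection (m : ℕ) (ι : Type*) [Fintype ι] (k : ℕ) :
    ∃ φ : Matrix (Fin m) ι ℝ → (EuclideanSpace ℝ (Fin m) →L[ℝ] EuclideanSpace ℝ (Fin m)),
      Measurable φ ∧ (∀ M, IsStarProjection (φ M) ∧ opTrace (φ M) ≤ k) ∧
      ∀ M (U : Submodule ℝ (EuclideanSpace ℝ (Fin m))), finrank ℝ U = k →
        IsDominantSubspace (Matrix.toEuclideanLin M.transpose) U →
        (∀ U' : Submodule ℝ (EuclideanSpace ℝ (Fin m)), finrank ℝ U' = k →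
          IsDominantSubspace (Matrix.toEuclideanLin M.transpose) U' → U' = U) →
        φ M = U.starProjection := by
  -- The vectors `P x` and `y - P y` run through the range of a projection `P` and its complement.
  -- With `x`, `y` fixed, dominance becomes a closed condition on the pair `(M, P)`.
  let R : Set (Matrix (Fin m) ι ℝ × (EuclideanSpace ℝ (Fin m) →L[ℝ] EuclideanSpace ℝ (Fin m))) :=
    {p | opTrace p.2 = k ∧ ∀ x y,
      ⟪Matrix.toEuclideanLin p.1.transpose (p.2 x),
        Matrix.toEuclideanLin p.1.transpose (y - p.2 y)⟫_ℝ = 0 ∧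
      ‖Matrix.toEuclideanLin p.1.transpose (y - p.2 y)‖ ^ 2 * ‖p.2 x‖ ^ 2 ≤
        ‖Matrix.toEuclideanLin p.1.transpose (p.2 x)‖ ^ 2 * ‖y - p.2 y‖ ^ 2}
  have hcont : ∀ f : Matrix (Fin m) ι ℝ ×
      (EuclideanSpace ℝ (Fin m) →L[ℝ] EuclideanSpace ℝ (Fin m)) → EuclideanSpace ℝ (Fin m),
      Continuous f → Continuous fun p => Matrix.toEuclideanLin p.1.transpose (f p) := by
    intro f hf
    simp_rw [Matrix.toLpLin_apply]
    refine (PiLp.continuous_toLp 2 _).comp (Continuous.matrix_mulVec ?_ ?_)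
    · exact continuous_fst.matrix_transpose
    · exact (PiLp.continuous_ofLp 2 _).comp hf
  have hR : IsClosed R := by
    have hR' : R = {p | opTrace p.2 = k} ∩ ⋂ x, ⋂ y, {p |
      ⟪Matrix.toEuclideanLin p.1.transpose (p.2 x),
        Matrix.toEuclideanLin p.1.transpose (y - p.2 y)⟫_ℝ = 0} ∩ {p |
      ‖Matrix.toEuclideanLin p.1.transpose (y - p.2 y)‖ ^ 2 * ‖p.2 x‖ ^ 2 ≤
        ‖Matrix.toEuclideanLin p.1.transpose (p.2 x)‖ ^ 2 * ‖y - p.2 y‖ ^ 2} := by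
      ext p
      simp only [R, Set.mem_inter_iff, Set.mem_iInter, Set.mem_ofPred_eq]
    rw [hR']
    refine (isClosed_eq (continuous_opTrace.comp continuous_snd) continuous_const).inter
      (isClosed_iInter fun x => isClosed_iInter fun y => ?_)
    have h1 := hcont (fun p => p.2 x) (by fun_prop)
    have h2 := hcont (fun p => y - p.2 y) (by fun_prop)
    exact (isClosed_eq (h1.inner h2) continuous_const).inter
      (isClosed_le ((h2.norm.pow 2).mul (by fun_prop)) ((h1.norm.pow 2).mul (by fun_prop)))
  obtain ⟨φ, hφm, hφK, hφ⟩ := exists_measurable_eq_of_unique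
    (isCompact_setOf_isStarProjection (m := m) (k : ℝ)) hR (y₀ := 0)
    ⟨IsStarProjection.zero _, by rw [opTrace_zero]; positivity⟩
  refine ⟨φ, hφm, hφK, fun M U hUk hU hun => hφ M _ ⟨isStarProjection_starProjection,
    by rw [opTrace_starProjection, hUk]⟩ ⟨?_, fun x y => ?_⟩ ?_⟩
  · simp only [opTrace_starProjection, hUk]
  · have h1 := U.starProjection_apply_mem x
    have h2 := U.sub_starProjection_mem_orthogonal y
    exact ⟨hU.inner_eq_zero _ h1 _ h2, hU.le _ h1 _ h2⟩
  · rintro P ⟨hP, -⟩ ⟨hPk, hPR⟩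
    obtain ⟨U', _, hU'⟩ := isStarProjection_iff_eq_starProjection.1 hP
    subst hU'
    suffices h : U' = U by subst h; rfl
    refine hun U' ?_ ?_
    · have := (opTrace_starProjection U').symm.trans hPk
      exact_mod_cast this
    · have hw : ∀ w ∈ U'ᗮ, w - U'.starProjection w = w := fun w hw => by
        rw [(Submodule.starProjection_apply_eq_zero_iff U').2 hw, sub_zero]
      refine ⟨fun u hu w hw' => ?_, fun u hu w hw' => ?_⟩
      · have := (hPR u w).1
        simp only [hw w hw', Submodule.starProjection_eq_self_iff.2 hu] at this
        exact this
      · have := (hPR u w).2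
        simp only [hw w hw', Submodule.starProjection_eq_self_iff.2 hu] at this
        exact this

end LeadingProjection

/-! ### Chi-squared tails for projected Gaussian vectors -/

section GaussianConcentration

open Module
open scoped InnerProductSpace

lemma gaussianPDFReal_mul_exp_sq (s x : ℝ) :
    gaussianPDFReal 0 1 x * Real.exp (s * x ^ 2) =
      (√(2 * Real.pi))⁻¹ * Real.exp (-((1 - 2 * s) / 2) * x ^ 2) := by
  rw [gaussianPDFReal, mul_assoc, ← Real.exp_add]
  simp only [NNReal.coe_one, mul_one, sub_zero]
  ring_nf

lemma integrable_exp_mul_sq_gaussianReal {s : ℝ} (hs : s < 1 / 2) :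
    Integrable (fun x => Real.exp (s * x ^ 2)) (gaussianReal 0 1) := by
  rw [gaussianReal_of_var_ne_zero _ one_ne_zero, integrable_withDensity_iff_integrable_smul'
    (measurable_gaussianPDF 0 1) (Eventually.of_forall fun _ => ENNReal.ofReal_lt_top)]
  have h : ∀ x, (gaussianPDF 0 1 x).toReal • Real.exp (s * x ^ 2) =
      (√(2 * Real.pi))⁻¹ * Real.exp (-((1 - 2 * s) / 2) * x ^ 2) := fun x => by
    rw [gaussianPDF, ENNReal.toReal_ofReal (gaussianPDFReal_nonneg _ _ _), smul_eq_mul,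
      gaussianPDFReal_mul_exp_sq]
  simp_rw [h]
  exact (integrable_exp_neg_mul_sq (by linarith)).const_mul _

lemma integral_exp_mul_sq_gaussianReal {s : ℝ} (hs : s < 1 / 2) :
    ∫ x, Real.exp (s * x ^ 2) ∂(gaussianReal 0 1) = (√(1 - 2 * s))⁻¹ := by
  rw [integral_gaussianReal_eq_integral_smul one_ne_zero]
  simp_rw [smul_eq_mul, gaussianPDFReal_mul_exp_sq]
  rw [integral_const_mul, integral_gaussian]
  have h1 : Real.pi / ((1 - 2 * s) / 2) = (2 * Real.pi) / (1 - 2 * s) := by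
    have : 1 - 2 * s ≠ 0 := by linarith
    field_simp
  rw [h1, Real.sqrt_div (by positivity)]
  have : √(2 * Real.pi) ≠ 0 := by positivity
  field_simp

lemma mul_lt_half {t c : ℝ} (ht : t < 1 / 2) (hc0 : 0 ≤ c) (hc1 : c ≤ 1) : t * c < 1 / 2 := by
  rcases le_total t 0 with h | h
  · linarith [mul_nonpos_of_nonpos_of_nonneg h hc0]
  · linarith [mul_le_of_le_one_right h hc1]

/-- This follows from `log y ≥ 1 - 1 / y`. The exponent is linear in `c`, so the product over the
eigenvalues of a projection depends on its trace alone. Both signs of `t` are needed, for the two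
tails. -/
lemma inv_sqrt_one_sub_le {t c : ℝ} (ht : t < 1 / 2) (hc0 : 0 ≤ c) (hc1 : c ≤ 1) :
    (√(1 - 2 * (t * c)))⁻¹ ≤ Real.exp (t / (1 - 2 * t) * c) := by
  have h1 : 0 < 1 - 2 * (t * c) := by linarith [mul_lt_half ht hc0 hc1]
  have h2 : 0 < 1 - 2 * t := by linarith
  rw [← Real.exp_log (inv_pos.2 (Real.sqrt_pos.2 h1)), Real.log_inv, Real.log_sqrt h1.le]
  refine Real.exp_le_exp.2 ?_
  have h3 := Real.one_sub_inv_le_log_of_pos h1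
  have h4 : 1 - (1 - 2 * (t * c))⁻¹ = -2 * (t * c / (1 - 2 * (t * c))) := by
    rw [inv_eq_one_div, mul_div_assoc', eq_div_iff h1.ne', sub_mul, div_mul_cancel₀ _ h1.ne']
    ring
  have h5 : t * c / (1 - 2 * (t * c)) ≤ t / (1 - 2 * t) * c := by
    rw [div_mul_eq_mul_div, div_le_div_iff₀ h1 h2]
    nlinarith [mul_nonneg (mul_nonneg (sq_nonneg t) hc0) (sub_nonneg.2 hc1)]
  linarith

variable {m : ℕ}

/-- Moment generating function of the squared length of a projection of a standard Gaussian. -/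
lemma mgf_norm_sq_starProjection_le
    {Q : EuclideanSpace ℝ (Fin m) →L[ℝ] EuclideanSpace ℝ (Fin m)} (hQ : IsStarProjection Q)
    {t : ℝ} (ht : t < 1 / 2) :
    Integrable (fun x => Real.exp (t * ‖Q x‖ ^ 2)) (stdGaussian (EuclideanSpace ℝ (Fin m))) ∧
      mgf (fun x => ‖Q x‖ ^ 2) (stdGaussian (EuclideanSpace ℝ (Fin m))) t ≤
        Real.exp (t / (1 - 2 * t) * opTrace Q) := by
  have hsym : (Q : EuclideanSpace ℝ (Fin m) →ₗ[ℝ] EuclideanSpace ℝ (Fin m)).IsSymmetric :=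
    hQ.isSelfAdjoint.isSymmetric
  have hidem : ∀ x, Q (Q x) = Q x := fun x => DFunLike.congr_fun hQ.isIdempotentElem.eq x
  have hsq : ∀ x, ‖Q x‖ ^ 2 = ⟪Q x, x⟫_ℝ := fun x => by
    rw [← real_inner_self_eq_norm_sq]
    have := hsym (Q x) x
    simp only [ContinuousLinearMap.coe_coe, hidem] at this
    exact this.symm
  let e := hsym.eigenvectorBasis rfl
  let c : Fin (finrank ℝ (EuclideanSpace ℝ (Fin m))) → ℝ := hsym.eigenvalues rfl
  have hQe : ∀ i, Q (e i) = c i • e i := fun i => hsym.apply_eigenvectorBasis rfl i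
  have hc : ∀ i, c i = ‖Q (e i)‖ ^ 2 := fun i => by
    rw [hsq, hQe, real_inner_smul_left, real_inner_self_eq_norm_sq, e.orthonormal.1]; simp
  have hc0 : ∀ i, 0 ≤ c i := fun i => by rw [hc]; positivity
  have hc1 : ∀ i, c i ≤ 1 := fun i => by
    have h1 := Q.le_of_opNorm_le (IsStarProjection.norm_le Q hQ) (e i)
    rw [e.orthonormal.1, mul_one] at h1
    rw [hc]
    exact pow_le_one₀ (norm_nonneg _) h1
  have htr : opTrace Q = ∑ i, c i := hsym.trace_eq_sum_eigenvalues rfl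
  have hnorm : ∀ x : Fin (finrank ℝ (EuclideanSpace ℝ (Fin m))) → ℝ,
      Real.exp (t * ‖Q (∑ i, x i • e i)‖ ^ 2) = ∏ i, Real.exp (t * c i * x i ^ 2) := by
    intro x
    rw [← Real.exp_sum, hsq, map_sum]
    simp_rw [map_smul, hQe, smul_smul]
    rw [e.orthonormal.inner_sum, Finset.mul_sum]
    congr 1
    refine Finset.sum_congr rfl fun i _ => ?_
    rw [conj_trivial]; ring
  have htc : ∀ i, t * c i < 1 / 2 := fun i => mul_lt_half ht (hc0 i) (hc1 i)
  have hmeas : Measurable fun x : Fin (finrank ℝ (EuclideanSpace ℝ (Fin m))) → ℝ =>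
      ∑ i, x i • e i := by fun_prop
  have hint : Integrable (fun x : Fin (finrank ℝ (EuclideanSpace ℝ (Fin m))) → ℝ =>
      Real.exp (t * ‖Q (∑ i, x i • e i)‖ ^ 2)) (Measure.pi fun _ => gaussianReal 0 1) := by
    simp_rw [hnorm]
    exact Integrable.fintype_prod (f := fun i y => Real.exp (t * c i * y ^ 2))
      fun i => integrable_exp_mul_sq_gaussianReal (htc i)
  have hcont : Continuous fun x => Real.exp (t * ‖Q x‖ ^ 2) := by fun_prop
  rw [mgf, stdGaussian_eq_map_pi_orthonormalBasis e]
  refine ⟨?_, ?_⟩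
  · rw [integrable_map_measure hcont.aestronglyMeasurable hmeas.aemeasurable]
    exact hint
  · rw [integral_map hmeas.aemeasurable hcont.aestronglyMeasurable]
    simp_rw [hnorm]
    rw [integral_fintype_prod_eq_prod (f := fun i y => Real.exp (t * c i * y ^ 2)), htr,
      Finset.mul_sum, Real.exp_sum]
    refine Finset.prod_le_prod (fun i _ => integral_nonneg fun _ => (Real.exp_pos _).le)
      fun i _ => ?_
    rw [integral_exp_mul_sq_gaussianReal (htc i)]
    exact inv_sqrt_one_sub_le ht (hc0 i) (hc1 i)

/-- Lower tail of the squared length of a projection of a standard Gaussian. -/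
lemma stdGaussian_norm_sq_le_le
    {Q : EuclideanSpace ℝ (Fin m) →L[ℝ] EuclideanSpace ℝ (Fin m)} (hQ : IsStarProjection Q)
    {d s τ : ℝ} (hd : d ≤ opTrace Q) (hs : 0 ≤ s) :
    stdGaussian (EuclideanSpace ℝ (Fin m)) {x | ‖Q x‖ ^ 2 ≤ τ} ≤
      ENNReal.ofReal (Real.exp (s * τ - s / (1 + 2 * s) * d)) := by
  obtain ⟨h1, h2⟩ := mgf_norm_sq_starProjection_le hQ (t := -s) (by linarith)
  have h3 := measure_le_le_exp_mul_mgf (X := fun x => ‖Q x‖ ^ 2) τ (by linarith) h1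
  refine (ENNReal.le_ofReal_iff_toReal_le (measure_ne_top _ _) (Real.exp_pos _).le).2
    (h3.trans ?_)
  calc _ ≤ Real.exp (- -s * τ) * Real.exp (-s / (1 - 2 * -s) * opTrace Q) := by gcongr
    _ = Real.exp (s * τ - s / (1 + 2 * s) * opTrace Q) := by
        rw [← Real.exp_add]; congr 1; ring
    _ ≤ _ := by gcongr

/-- Upper tail of the squared length of a standard Gaussian. -/
lemma stdGaussian_le_norm_sq_le {t τ : ℝ} (ht0 : 0 ≤ t) (ht : t < 1 / 2) :
    stdGaussian (EuclideanSpace ℝ (Fin m)) {x | τ ≤ ‖x‖ ^ 2} ≤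
      ENNReal.ofReal (Real.exp (t / (1 - 2 * t) * m - t * τ)) := by
  obtain ⟨h1, h2⟩ := mgf_norm_sq_starProjection_le (m := m) (Q := 1) (IsStarProjection.one _) ht
  have h3 := measure_ge_le_exp_mul_mgf (X := fun x : EuclideanSpace ℝ (Fin m) =>
    ‖(1 : EuclideanSpace ℝ (Fin m) →L[ℝ] EuclideanSpace ℝ (Fin m)) x‖ ^ 2) τ ht0 h1
  refine (ENNReal.le_ofReal_iff_toReal_le (measure_ne_top _ _) (Real.exp_pos _).le).2
    (h3.trans ?_)
  have h4 : opTrace (1 : EuclideanSpace ℝ (Fin m) →L[ℝ] EuclideanSpace ℝ (Fin m)) = m := by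
    simpa [opTrace_zero] using opTrace_one_sub (m := m) 0
  rw [h4] at h2
  calc _ ≤ Real.exp (-t * τ) * Real.exp (t / (1 - 2 * t) * m) := by gcongr
    _ = _ := by rw [← Real.exp_add]; congr 1; ring

variable {Ω : Type*} [MeasurableSpace Ω] {P : Measure Ω} {n : ℕ}
  {A : Ω → Matrix (Fin m) (Fin n) ℝ}

/-- The rescaled columns of a Gaussian sensing matrix are standard Gaussian vectors. -/
lemma IsGaussianSensing.map_smul_euclideanCol [IsProbabilityMeasure P]
    (hA : IsGaussianSensing A P) (hm : 0 < m) (j : Fin n) :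
    P.map (fun ω => √(m : ℝ) • euclideanCol (A ω) j) =
      stdGaussian (EuclideanSpace ℝ (Fin m)) := by
  have hmeas : ∀ i, Measurable fun ω => √(m : ℝ) * A ω i j := fun i =>
    ((measurable_pi_apply j).comp ((measurable_pi_apply i).comp hA.measurable)).const_mul _
  have hlaw : ∀ i, P.map (fun ω => √(m : ℝ) * A ω i j) = gaussianReal 0 1 := by
    intro i
    rw [(gaussianReal_const_mul (hA.law i j) (√(m : ℝ))).map_eq]
    congr 1
    · simp
    · ext
      have : (m : ℝ) ≠ 0 := by positivity
      simp [Real.sq_sqrt, this]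
  have hind : iIndepFun (fun i ω => √(m : ℝ) * A ω i j) P := by
    have h1 : iIndepFun (fun i ω => A ω i j) P :=
      hA.indep.precomp (g := fun i => (i, j)) fun a b h => congrArg Prod.fst h
    exact h1.comp (fun _ x => √(m : ℝ) * x) fun _ => measurable_const_mul _
  rw [iIndepFun_iff_map_fun_eq_pi_map fun i => (hmeas i).aemeasurable] at hind
  simp_rw [hlaw] at hind
  rw [← map_pi_eq_stdGaussian, ← hind, Measure.map_map (by fun_prop) (measurable_pi_lambda _ hmeas)]
  rfl

end GaussianConcentration

/-! ### The run restricted to the support -/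

section OracleRun

open Module
open scoped InnerProductSpace

variable {m n r : ℕ}

/-- A measurable choice of the projection onto the dominant `k`-dimensional subspace. -/
noncomputable def dominantProjection (m : ℕ) (ι : Type*) [Fintype ι] (k : ℕ) :
    Matrix (Fin m) ι ℝ → (EuclideanSpace ℝ (Fin m) →L[ℝ] EuclideanSpace ℝ (Fin m)) :=
  (exists_measurable_dominantProjection m ι k).choose

lemma measurable_dominantProjection (m : ℕ) (ι : Type*) [Fintype ι] (k : ℕ) :
    Measurable (dominantProjection m ι k) :=
  (exists_measurable_dominantProjection m ι k).choose_spec.1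

lemma isStarProjection_dominantProjection {ι : Type*} [Fintype ι] (k : ℕ)
    (M : Matrix (Fin m) ι ℝ) : IsStarProjection (dominantProjection m ι k M) :=
  ((exists_measurable_dominantProjection m ι k).choose_spec.2.1 M).1

lemma opTrace_dominantProjection_le {ι : Type*} [Fintype ι] (k : ℕ)
    (M : Matrix (Fin m) ι ℝ) : opTrace (dominantProjection m ι k M) ≤ k :=
  ((exists_measurable_dominantProjection m ι k).choose_spec.2.1 M).2

lemma dominantProjection_eq {ι : Type*} [Fintype ι] {k : ℕ} {M : Matrix (Fin m) ι ℝ}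
    {U : Submodule ℝ (EuclideanSpace ℝ (Fin m))} (hUk : finrank ℝ U = k)
    (hU : IsDominantSubspace (Matrix.toEuclideanLin M.transpose) U)
    (hun : ∀ U' : Submodule ℝ (EuclideanSpace ℝ (Fin m)), finrank ℝ U' = k →
      IsDominantSubspace (Matrix.toEuclideanLin M.transpose) U' → U' = U) :
    dominantProjection m ι k M = U.starProjection :=
  (exists_measurable_dominantProjection m ι k).choose_spec.2.2 M U hUk hU hun

/-- The residual of `x` after projection onto the dominant subspace of `[A_T  St]`. -/
noncomputable def dominantResidual (k : ℕ) (A : Matrix (Fin m) (Fin n) ℝ) (St : Matrix (Fin m) (Fin r) ℝ)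
    (T : Finset (Fin n)) (x : EuclideanSpace ℝ (Fin m)) : EuclideanSpace ℝ (Fin m) :=
  (1 - dominantProjection m (T ⊕ Fin r) k (augmented A T St)) x

/-- The measurable version of the MUSIC score. -/
noncomputable def oracleScore (k : ℕ) (A : Matrix (Fin m) (Fin n) ℝ)
    (St : Matrix (Fin m) (Fin r) ℝ) (T : Finset (Fin n)) (j : Fin n) : ℝ :=
  ‖dominantResidual k A St T (euclideanCol A j)‖ ^ 2

/-- The one-by-one selection restricted to the indices of the support. -/
def OracleRun (k : ℕ) (A : Matrix (Fin m) (Fin n) ℝ) (St : Matrix (Fin m) (Fin r) ℝ)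
    (I supp : Finset (Fin n)) : ℕ → Finset (Fin n) → Prop
  | 0, T => T = I
  | q + 1, T' => ∃ T, OracleRun k A St I supp q T ∧ ∃ j ∈ supp \ T, T' = insert j T ∧
      (∀ i ∈ supp \ T, oracleScore k A St T j ≤ oracleScore k A St T i) ∧
      (∀ i ∈ supp \ T, oracleScore k A St T i = oracleScore k A St T j → j ≤ i)

variable {A A' : Matrix (Fin m) (Fin n) ℝ} {S St : Matrix (Fin m) (Fin r) ℝ} {k p q : ℕ}
  {I supp T T' : Finset (Fin n)} {γ ε τ : ℝ}

/-- The tie-breaking rule makes the run deterministic, so each step contributes a single set `T` to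
the union bound. -/
lemma OracleRun.unique (h : OracleRun k A St I supp q T) (h' : OracleRun k A St I supp q T') :
    T = T' := by
  induction q generalizing T T' with
  | zero => exact h.trans h'.symm
  | succ q ih =>
    obtain ⟨T₁, h₁, j, hj, rfl, hmin, htie⟩ := h
    obtain ⟨T₂, h₂, j', hj', rfl, hmin', htie'⟩ := h'
    obtain rfl := ih h₁ h₂
    have he := le_antisymm (hmin j' hj') (hmin' j hj)
    rw [le_antisymm (htie j' hj' he.symm) (htie' j hj he)]

lemma OracleRun.subset (hI : I ⊆ supp) (h : OracleRun k A St I supp q T) : I ⊆ T ∧ T ⊆ supp := by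
  induction q generalizing T with
  | zero => obtain rfl : T = I := h; exact ⟨subset_rfl, hI⟩
  | succ q ih =>
    obtain ⟨T₁, h₁, j, hj, rfl, -, -⟩ := h
    exact ⟨(ih h₁).1.trans (Finset.subset_insert _ _),
      Finset.insert_subset (Finset.mem_sdiff.1 hj).1 (ih h₁).2⟩

lemma augmented_congr (hA : ∀ j ∈ supp, ∀ i, A i j = A' i j) (hT : T ⊆ supp) :
    augmented A T St = augmented A' T St := by
  have : A.submatrix id (fun i : T => (i : Fin n)) = A'.submatrix id (fun i : T => (i : Fin n)) := by
    ext i j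
    exact hA _ (hT j.2) i
  rw [augmented, augmented, this]

lemma oracleScore_congr (hA : ∀ j ∈ supp, ∀ i, A i j = A' i j) (hT : T ⊆ supp) {j : Fin n}
    (hj : j ∈ supp) : oracleScore k A St T j = oracleScore k A' St T j := by
  have : euclideanCol A j = euclideanCol A' j := by
    ext i
    exact hA j hj i
  rw [oracleScore, oracleScore, dominantResidual, dominantResidual, augmented_congr hA hT, this]

/-- Given `St`, the run reads only support columns; an outside column can therefore be erased
without changing it. -/
lemma OracleRun.congr (hA : ∀ j ∈ supp, ∀ i, A i j = A' i j) (hI : I ⊆ supp)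
    (h : OracleRun k A St I supp q T) : OracleRun k A' St I supp q T := by
  induction q generalizing T with
  | zero => exact h
  | succ q ih =>
    obtain ⟨T₁, h₁, j, hj, rfl, hmin, htie⟩ := h
    have hT₁ := (h₁.subset hI).2
    have hs : ∀ i ∈ supp \ T₁, oracleScore k A' St T₁ i = oracleScore k A St T₁ i :=
      fun i hi => (oracleScore_congr hA hT₁ (Finset.mem_sdiff.1 hi).1).symm
    refine ⟨T₁, ih h₁, j, hj, rfl, fun i hi => ?_, fun i hi he => ?_⟩
    · rw [hs i hi, hs j hj]; exact hmin i hi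
    · rw [hs i hi, hs j hj] at he; exact htie i hi he

lemma SnrCondition.oracleScore_eq (h : SnrCondition A S St k I γ) (hk : 0 < k) (hγ : γ < 1)
    (h0γ : 0 ≤ γ) (hI : I ⊆ supp) (hcard : supp.card = k)
    (hS : ∀ c, WithLp.toLp 2 (S.mulVec c) ∈ columnSpan A supp) (hIT : I ⊆ T) (hT : T ⊆ supp)
    {U : Submodule ℝ (EuclideanSpace ℝ (Fin m))}
    (hU : IsLeadingLeftSingularSpace (augmented A T St) k U) (j : Fin n) :
    oracleScore k A St T j = musicScore A U j := by
  obtain ⟨hUk, hUd⟩ := hU.finrank_eq_and_isDominantSubspace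
  have h1 : dominantProjection m (T ⊕ Fin r) k (augmented A T St) = U.starProjection :=
    dominantProjection_eq hUk hUd fun U' hUk' hUd' =>
      h.eq_of_isDominantSubspace hk hγ h0γ hI hcard hS hIT hT hUk hUd hUk' hUd'
  rw [oracleScore, dominantResidual, h1, musicScore, sub_apply,
    one_apply_eq_self, Submodule.starProjection_orthogonal_val]
  rfl

/-- The generalized MUSIC steps succeed as soon as the support columns have length about one and
the scores of the other columns along the restricted run are not too small. -/
theorem SnrCondition.musicRecovers (h : SnrCondition A S St k I γ) (hγ : γ < 1)
    (h0γ : 0 ≤ γ) (hI : I ⊆ supp) (hcard : supp.card = k) (hp : I.card + p = k)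
    (hS : ∀ c, WithLp.toLp 2 (S.mulVec c) ∈ columnSpan A supp)
    (hτ : dampingFactor γ * ε ≤ τ) (hin : ∀ j ∈ supp, ‖euclideanCol A j‖ ^ 2 ≤ ε)
    (hout : ∀ q < p, ∀ T, OracleRun k A St I supp q T → ∀ j ∉ supp, τ < oracleScore k A St T j) :
    MusicRecovers A St k I p supp := by
  have hsd : (supp \ I).card = p := by
    rw [Finset.card_sdiff_of_subset hI]; omega
  -- With nothing left to find, `k` may be 0 and the index `k - 1` is meaningless; `p > 0` forces `k
  -- > 0`.
  rcases Nat.eq_zero_or_pos p with rfl | hppos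
  · have hIs : I = supp := Finset.eq_of_subset_of_card_le hI (by omega)
    refine ⟨?_, ?_⟩
    · rintro J ⟨U, -, -, hJ, -⟩
      rw [Finset.card_eq_zero.1 hJ, Finset.card_eq_zero.1 hsd]
    · rintro T hT
      cases hT
      exact hIs
  have hk : 0 < k := by omega
  have hdf : 0 ≤ dampingFactor γ := le_min (sq_nonneg _) (by norm_num)
  have hlow : ∀ T, I ⊆ T → T ⊆ supp → ∀ U, IsLeadingLeftSingularSpace (augmented A T St) k U →
      ∀ j ∈ supp, musicScore A U j ≤ τ := by
    intro T hIT hT U hU j hj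
    obtain ⟨hUk, hUd⟩ := hU.finrank_eq_and_isDominantSubspace
    refine (h.musicScore_le hk hγ h0γ hI hcard hS hIT hT hUk hUd hj).trans (le_trans ?_ hτ)
    exact mul_le_mul_of_nonneg_left (hin j hj) hdf
  refine ⟨?_, ?_⟩
  · rintro J ⟨U, hU, hIJ, hJ, hmin⟩
    have hsc := h.oracleScore_eq hk hγ h0γ hI hcard hS subset_rfl hI hU
    have hJs : J ⊆ supp := by
      intro j hj
      by_contra hjs
      -- By counting, a wrong choice `j` leaves out some support index `i`, whose score is at most
      -- `τ`, below that of `j`.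
      have : ∃ i ∈ supp \ I, i ∉ J := by
        by_contra! hc
        have := Finset.eq_of_subset_of_card_le (s := supp \ I) hc (by omega)
        exact hjs (Finset.mem_sdiff.1 (this ▸ hj)).1
      obtain ⟨i, hi, hiJ⟩ := this
      obtain ⟨his, hiI⟩ := Finset.mem_sdiff.1 hi
      have h1 := hmin j hj i hiI hiJ
      have h2 := hlow I subset_rfl hI U hU i his
      have h3 := hout 0 hppos I rfl j hjs
      rw [hsc] at h3
      linarith
    refine Finset.eq_of_subset_of_card_le (fun j hj => Finset.mem_sdiff.2 ⟨hJs hj, ?_⟩) (by omega)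
    exact fun hjI => Finset.disjoint_left.1 hIJ hjI hj
  -- By induction the true run is the restricted one: before step `p` a support index is still
  -- missing, and it beats every outside index.
  · have key : ∀ q T, SeqMusicRun A St k I q T → q ≤ p →
        OracleRun k A St I supp q T ∧ T.card = I.card + q := by
      intro q T hT
      induction hT with
      | start => exact fun _ => ⟨rfl, rfl⟩
      | step q T U j hT hU hjT hmin htie ih =>
        intro hq
        obtain ⟨hrun, hTc⟩ := ih (by omega)
        obtain ⟨hIT, hTs⟩ := hrun.subset hI
        have hsc := h.oracleScore_eq hk hγ h0γ hI hcard hS hIT hTs hU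
        have hjs : j ∈ supp := by
          by_contra hjs
          obtain ⟨i, his, hiT⟩ : ∃ i ∈ supp, i ∉ T := by
            by_contra! hc
            have := Finset.card_le_card (s := supp) hc
            omega
          have h1 := hmin i hiT
          have h2 := hlow T hIT hTs U hU i his
          have h3 := hout q (by omega) T hrun j hjs
          rw [hsc] at h3
          linarith
        refine ⟨⟨T, hrun, j, Finset.mem_sdiff.2 ⟨hjs, hjT⟩, rfl, fun i hi => ?_,
          fun i hi he => ?_⟩, ?_⟩
        · rw [hsc, hsc]
          exact hmin i (Finset.mem_sdiff.1 hi).2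
        · rw [hsc, hsc] at he
          exact htie i (Finset.mem_sdiff.1 hi).2 he
        · rw [Finset.card_insert_of_notMem hjT]; omega
    intro T hT
    obtain ⟨hrun, hTc⟩ := key p T hT le_rfl
    exact Finset.eq_of_subset_of_card_le (hrun.subset hI).2 (by omega)

section Measurability

variable {Z : Type*} [MeasurableSpace Z]

lemma measurable_augmented {a : Z → Matrix (Fin m) (Fin n) ℝ} {s : Z → Matrix (Fin m) (Fin r) ℝ}
    (ha : Measurable a) (hs : Measurable s) (T : Finset (Fin n)) :
    Measurable fun z => augmented (a z) T (s z) := by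
  refine measurable_pi_lambda _ fun i => measurable_pi_lambda _ fun j => ?_
  rcases j with j | j
  · change Measurable fun z => a z i j
    exact (measurable_pi_apply (j : Fin n)).comp ((measurable_pi_apply i).comp ha)
  · change Measurable fun z => s z i j
    exact (measurable_pi_apply j).comp ((measurable_pi_apply i).comp hs)

lemma measurable_euclideanCol {a : Z → Matrix (Fin m) (Fin n) ℝ} (ha : Measurable a)
    (j : Fin n) : Measurable fun z => euclideanCol (a z) j := by
  refine (WithLp.measurable_toLp 2 (Fin m → ℝ)).comp (measurable_pi_lambda _ fun i => ?_)
  exact (measurable_pi_apply j).comp ((measurable_pi_apply i).comp ha)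

lemma measurable_dominantResidual {a : Z → Matrix (Fin m) (Fin n) ℝ} {s : Z → Matrix (Fin m) (Fin r) ℝ}
    {x : Z → EuclideanSpace ℝ (Fin m)} (ha : Measurable a) (hs : Measurable s) (hx : Measurable x)
    (T : Finset (Fin n)) : Measurable fun z => dominantResidual k (a z) (s z) T (x z) := by
  have h1 := (measurable_dominantProjection m (T ⊕ Fin r) k).comp (measurable_augmented ha hs T)
  exact hx.sub (ContinuousLinearMap.measurable_apply₂.comp (h1.prodMk hx))

lemma measurableSet_oracleRun {a : Z → Matrix (Fin m) (Fin n) ℝ}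
    {s : Z → Matrix (Fin m) (Fin r) ℝ} (ha : Measurable a) (hs : Measurable s)
    (I supp : Finset (Fin n)) (q : ℕ) (T : Finset (Fin n)) :
    MeasurableSet {z | OracleRun k (a z) (s z) I supp q T} := by
  have hscore : ∀ T j, Measurable fun z => oracleScore k (a z) (s z) T j := fun T j =>
    (measurable_dominantResidual ha hs (measurable_euclideanCol ha j) T).norm.pow_const 2
  induction q generalizing T with
  | zero => exact MeasurableSet.const _
  | succ q ih =>
    have : {z | OracleRun k (a z) (s z) I supp (q + 1) T} =
        ⋃ T₁, {z | OracleRun k (a z) (s z) I supp q T₁} ∩ ⋃ j ∈ supp \ T₁,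
          {_z | T = insert j T₁} ∩
          ((⋂ i ∈ supp \ T₁, {z | oracleScore k (a z) (s z) T₁ j ≤ oracleScore k (a z) (s z) T₁ i}) ∩
          ⋂ i ∈ supp \ T₁, ({z | oracleScore k (a z) (s z) T₁ i = oracleScore k (a z) (s z) T₁ j}ᶜ ∪
            {_z | j ≤ i})) := by
      ext z
      simp only [OracleRun, Set.mem_ofPred_eq, Set.mem_iUnion, Set.mem_inter_iff, Set.mem_iInter,
        Set.mem_union, Set.mem_compl_iff, exists_prop, imp_iff_not_or]
    rw [this]
    refine MeasurableSet.iUnion fun T₁ => (ih T₁).inter (Finset.measurableSet_biUnion _ fun j _ =>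
      (MeasurableSet.const _).inter (MeasurableSet.inter ?_ ?_))
    · exact Finset.measurableSet_biInter _ fun i _ => measurableSet_le (hscore _ _) (hscore _ _)
    · exact Finset.measurableSet_biInter _ fun i _ =>
        (measurableSet_eq_fun (hscore _ _) (hscore _ _)).compl.union (MeasurableSet.const _)

end Measurability

end OracleRun

/-! ### Failure probability in fixed dimensions -/

section FiniteDimension

open Module
open scoped InnerProductSpace

/-- If `Z` is independent of `g` and the pair is independent of `W`, then sections over `(Z, W)`
control the probability of an event. -/
lemma measure_preimage_le_of_sections {Ω α β δ : Type*} [MeasurableSpace Ω] [MeasurableSpace α]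
    [MeasurableSpace β] [MeasurableSpace δ] {P : Measure Ω} [IsProbabilityMeasure P]
    {Z : Ω → α} {W : Ω → β} {g : Ω → δ} (hZ : Measurable Z) (hW : Measurable W)
    (hg : Measurable g) (hZg : IndepFun Z g P) (hZgW : IndepFun (fun ω => (Z ω, g ω)) W P)
    {C : Set ((α × β) × δ)} (hC : MeasurableSet C) {c : ENNReal}
    (hsec : ∀ z w, P.map g {x | ((z, w), x) ∈ C} ≤ c) :
    P {ω | ((Z ω, W ω), g ω) ∈ C} ≤ c := by
  have : IsProbabilityMeasure (P.map W) := Measure.isProbabilityMeasure_map hW.aemeasurable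
  have : IsProbabilityMeasure (P.map Z) := Measure.isProbabilityMeasure_map hZ.aemeasurable
  have : IsProbabilityMeasure (P.map g) := Measure.isProbabilityMeasure_map hg.aemeasurable
  let C' : Set (β × (α × δ)) := {p | ((p.2.1, p.1), p.2.2) ∈ C}
  have hC' : MeasurableSet C' := hC.preimage (by fun_prop)
  have h1 := (indepFun_iff_map_prod_eq_prod_map_map hW.aemeasurable
    (hZ.prodMk hg).aemeasurable).1 hZgW.symm
  rw [(indepFun_iff_map_prod_eq_prod_map_map hZ.aemeasurable hg.aemeasurable).1 hZg] at h1
  have h2 : P {ω | ((Z ω, W ω), g ω) ∈ C} = P.map (fun ω => (W ω, (Z ω, g ω))) C' := by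
    rw [Measure.map_apply (hW.prodMk (hZ.prodMk hg)) hC']
    rfl
  rw [h2, h1, Measure.prod_apply hC']
  calc _ ≤ ∫⁻ _w, c ∂(P.map W) := by
        refine lintegral_mono fun w => ?_
        rw [Measure.prod_apply (hC'.preimage (by fun_prop))]
        calc _ ≤ ∫⁻ _z, c ∂(P.map Z) := lintegral_mono fun z => hsec z w
          _ = c := by simp
    _ = c := by simp

variable {m n N r : ℕ}

/-- `A` with its `j`-th column replaced by zero. -/
def zeroCol (j : Fin n) (A : Matrix (Fin m) (Fin n) ℝ) : Matrix (Fin m) (Fin n) ℝ :=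
  fun i j' => if j' = j then 0 else A i j'

lemma measurable_zeroCol (j : Fin n) : Measurable (zeroCol (m := m) j) := by
  refine measurable_pi_lambda _ fun i => measurable_pi_lambda _ fun j' => ?_
  unfold zeroCol
  split_ifs
  · exact measurable_const
  · exact (measurable_pi_apply j').comp (measurable_pi_apply i)

/-- Thus `Y`, and with it `St`, is a function of the remaining columns and the noise only. -/
lemma zeroCol_mul {X : Matrix (Fin n) (Fin N) ℝ} {j : Fin n} (hj : j ∉ rowSupport X)
    (A : Matrix (Fin m) (Fin n) ℝ) : zeroCol j A * X = A * X := by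
  have hXj : X j = 0 := by simpa [rowSupport] using hj
  ext i l
  rw [Matrix.mul_apply, Matrix.mul_apply]
  refine Finset.sum_congr rfl fun j' _ => ?_
  by_cases h : j' = j
  · subst h; rw [hXj]; simp
  · simp [zeroCol, h]

lemma measurable_matrix_mul {Z : Type*} [MeasurableSpace Z] {a : Z → Matrix (Fin m) (Fin n) ℝ}
    {b : Z → Matrix (Fin n) (Fin N) ℝ} (ha : Measurable a) (hb : Measurable b) :
    Measurable fun z => a z * b z := by
  refine measurable_pi_lambda _ fun i => measurable_pi_lambda _ fun j => ?_
  simp_rw [Matrix.mul_apply]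
  refine Finset.measurable_sum _ fun l _ => Measurable.mul ?_ ?_
  · exact (measurable_pi_apply l).comp ((measurable_pi_apply i).comp ha)
  · exact (measurable_pi_apply j).comp ((measurable_pi_apply l).comp hb)

/-- The signal subspace estimate `Y V(Y)` for `Y = A X + W`. -/
def subspaceEstimate (X : Matrix (Fin n) (Fin N) ℝ)
    (V : Matrix (Fin m) (Fin N) ℝ → Matrix (Fin N) (Fin r) ℝ)
    (A : Matrix (Fin m) (Fin n) ℝ) (W : Matrix (Fin m) (Fin N) ℝ) : Matrix (Fin m) (Fin r) ℝ :=
  (A * X + W) * V (A * X + W)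

lemma measurable_subspaceEstimate (X : Matrix (Fin n) (Fin N) ℝ)
    {V : Matrix (Fin m) (Fin N) ℝ → Matrix (Fin N) (Fin r) ℝ} (hV : Measurable V) :
    Measurable fun z : Matrix (Fin m) (Fin n) ℝ × Matrix (Fin m) (Fin N) ℝ =>
      subspaceEstimate X V z.1 z.2 := by
  have h1 : Measurable fun z : Matrix (Fin m) (Fin n) ℝ × Matrix (Fin m) (Fin N) ℝ =>
      z.1 * X + z.2 := by
    have h2 := measurable_matrix_mul (m := m) measurable_fst (measurable_const (a := X))
      (Z := Matrix (Fin m) (Fin n) ℝ × Matrix (Fin m) (Fin N) ℝ)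
    refine measurable_pi_lambda _ fun i => measurable_pi_lambda _ fun j => Measurable.add ?_ ?_
    · exact (measurable_pi_apply j).comp ((measurable_pi_apply i).comp h2)
    · exact (measurable_pi_apply j).comp ((measurable_pi_apply i).comp measurable_snd)
  exact measurable_matrix_mul h1 (hV.comp h1)

lemma measurable_sqrt_smul_euclideanCol (j : Fin n) :
    Measurable fun a : Matrix (Fin m) (Fin n) ℝ => √(m : ℝ) • euclideanCol a j :=
  (continuous_const_smul _).measurable.comp (measurable_euclideanCol measurable_id j)

variable {Ω : Type*} [MeasurableSpace Ω] {P : Measure Ω} {A : Ω → Matrix (Fin m) (Fin n) ℝ}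

lemma IsGaussianSensing.indepFun_zeroCol (hA : IsGaussianSensing A P) (j : Fin n) :
    IndepFun (fun ω => zeroCol j (A ω)) (fun ω => √(m : ℝ) • euclideanCol (A ω) j) P := by
  classical
  let s : Finset (Fin m × Fin n) := Finset.univ.filter fun p => p.2 ≠ j
  let t : Finset (Fin m × Fin n) := Finset.univ.filter fun p => p.2 = j
  have hst : Disjoint s t := by
    rw [Finset.disjoint_left]
    intro p hp hp'
    exact (Finset.mem_filter.1 hp).2 (Finset.mem_filter.1 hp').2
  have hmeas : ∀ p : Fin m × Fin n, Measurable fun ω => A ω p.1 p.2 := fun p =>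
    (measurable_pi_apply p.2).comp ((measurable_pi_apply p.1).comp hA.measurable)
  have h := hA.indep.indepFun_finset s t hst hmeas
  let f : (s → ℝ) → Matrix (Fin m) (Fin n) ℝ := fun x i j' =>
    if hj : j' = j then 0 else x ⟨(i, j'), by simp [s, hj]⟩
  let g : (t → ℝ) → EuclideanSpace ℝ (Fin m) := fun x =>
    √(m : ℝ) • WithLp.toLp 2 fun i => x ⟨(i, j), by simp [t]⟩
  have hf : Measurable f := by
    refine measurable_pi_lambda _ fun i => measurable_pi_lambda _ fun j' => ?_
    by_cases hj : j' = j
    · simp only [f, hj, dif_pos]; exact measurable_const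
    · simp only [f, hj, dif_neg, not_false_eq_true]; exact measurable_pi_apply _
  have hg : Measurable g :=
    (continuous_const_smul _).measurable.comp ((WithLp.measurable_toLp 2 (Fin m → ℝ)).comp
      (measurable_pi_lambda _ fun i => measurable_pi_apply _))
  have hfg := h.comp hf hg
  have e1 : (f ∘ fun ω (i : s) => A ω (i : Fin m × Fin n).1 (i : Fin m × Fin n).2) =
      fun ω => zeroCol j (A ω) := by
    funext ω i j'
    change (if _ : j' = j then 0 else A ω i j') = if j' = j then 0 else A ω i j'
    exact dite_eq_ite
  have e2 : (g ∘ fun ω (i : t) => A ω (i : Fin m × Fin n).1 (i : Fin m × Fin n).2) =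
      fun ω => √(m : ℝ) • euclideanCol (A ω) j := rfl
  rw [e1, e2] at hfg
  exact hfg

variable [IsProbabilityMeasure P]

lemma norm_sq_sqrt_smul (x : EuclideanSpace ℝ (Fin m)) :
    ‖√(m : ℝ) • x‖ ^ 2 = m * ‖x‖ ^ 2 := by
  rw [norm_smul, mul_pow, Real.norm_eq_abs, sq_abs, Real.sq_sqrt (Nat.cast_nonneg m)]

/-- The columns of a Gaussian sensing matrix are unlikely to be long. -/
lemma IsGaussianSensing.measure_le_norm_sq_euclideanCol (hA : IsGaussianSensing A P) (hm : 0 < m)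
    (j : Fin n) {t ε : ℝ} (ht0 : 0 ≤ t) (ht : t < 1 / 2) :
    P {ω | ε ≤ ‖euclideanCol (A ω) j‖ ^ 2} ≤
      ENNReal.ofReal (Real.exp (t / (1 - 2 * t) * m - t * (m * ε))) := by
  refine le_trans ?_ (stdGaussian_le_norm_sq_le ht0 ht)
  have hmeas : Measurable fun ω => √(m : ℝ) • euclideanCol (A ω) j :=
    (measurable_sqrt_smul_euclideanCol j).comp hA.measurable
  rw [← hA.map_smul_euclideanCol hm j, Measure.map_apply hmeas
    (measurableSet_le measurable_const (by fun_prop))]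
  refine measure_mono fun ω hω => ?_
  simp only [Set.mem_preimage, Set.mem_ofPred_eq, norm_sq_sqrt_smul] at hω ⊢
  gcongr

/-- The score of an index outside the support is unlikely to be small along the restricted run. -/
lemma IsGaussianSensing.measure_oracleScore_le (hA : IsGaussianSensing A P) (hm : 0 < m)
    {W : Ω → Matrix (Fin m) (Fin N) ℝ} (hW : Measurable W) (hAW : IndepFun A W P)
    {X : Matrix (Fin n) (Fin N) ℝ} {V : Matrix (Fin m) (Fin N) ℝ → Matrix (Fin N) (Fin r) ℝ}
    (hV : Measurable V) {I : Finset (Fin n)} (hI : I ⊆ rowSupport X) {j : Fin n}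
    (hj : j ∉ rowSupport X) (k q : ℕ) {s τ : ℝ} (hs : 0 ≤ s) :
    P {ω | ∃ T, OracleRun k (A ω) (subspaceEstimate X V (A ω) (W ω)) I (rowSupport X) q T ∧
      oracleScore k (A ω) (subspaceEstimate X V (A ω) (W ω)) T j ≤ τ} ≤
      ENNReal.ofReal (Real.exp (s * (m * τ) - s / (1 + 2 * s) * (m - k))) := by
  have hmg : Measurable fun ω => √(m : ℝ) • euclideanCol (A ω) j :=
    (measurable_sqrt_smul_euclideanCol j).comp hA.measurable
  have hmZ : Measurable fun ω => zeroCol j (A ω) := (measurable_zeroCol j).comp hA.measurable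
  have hind : IndepFun (fun ω => (zeroCol j (A ω), √(m : ℝ) • euclideanCol (A ω) j)) W P :=
    hAW.comp (φ := fun a => (zeroCol j a, √(m : ℝ) • euclideanCol a j)) (ψ := id)
      ((measurable_zeroCol j).prodMk (measurable_sqrt_smul_euclideanCol j))
      measurable_id
  -- The run and its projection use the matrix with column `j` erased, while the free last
  -- coordinate is the vector `√m a_j`; this accounts for the threshold `m * τ`.
  let C : Set ((Matrix (Fin m) (Fin n) ℝ × Matrix (Fin m) (Fin N) ℝ) ×
      EuclideanSpace ℝ (Fin m)) := {p | ∃ T,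
    OracleRun k p.1.1 (subspaceEstimate X V p.1.1 p.1.2) I (rowSupport X) q T ∧
      ‖dominantResidual k p.1.1 (subspaceEstimate X V p.1.1 p.1.2) T p.2‖ ^ 2 ≤ m * τ}
  have hC : MeasurableSet C := by
    have hest : Measurable fun p : (Matrix (Fin m) (Fin n) ℝ × Matrix (Fin m) (Fin N) ℝ) ×
        EuclideanSpace ℝ (Fin m) => subspaceEstimate X V p.1.1 p.1.2 :=
      (measurable_subspaceEstimate X hV).comp measurable_fst
    have hfst : Measurable fun p : (Matrix (Fin m) (Fin n) ℝ × Matrix (Fin m) (Fin N) ℝ) ×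
        EuclideanSpace ℝ (Fin m) => p.1.1 := by fun_prop
    have : C = ⋃ T, {p | OracleRun k p.1.1 (subspaceEstimate X V p.1.1 p.1.2) I
        (rowSupport X) q T} ∩
        {p | ‖dominantResidual k p.1.1 (subspaceEstimate X V p.1.1 p.1.2) T p.2‖ ^ 2 ≤ m * τ} := by
      ext p
      simp only [C, Set.mem_ofPred_eq, Set.mem_iUnion, Set.mem_inter_iff]
    rw [this]
    refine MeasurableSet.iUnion fun T => (measurableSet_oracleRun hfst hest I _ q T).inter ?_
    exact measurableSet_le
      ((measurable_dominantResidual hfst hest measurable_snd T).norm.pow_const 2) measurable_const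
  refine le_trans (measure_mono fun ω hω => ?_) (measure_preimage_le_of_sections hmZ hW hmg
    (hA.indepFun_zeroCol j) hind hC fun z w => ?_)
  · obtain ⟨T, hT, hsc⟩ := hω
    have hcongr : ∀ j' ∈ rowSupport X, ∀ i, A ω i j' = zeroCol j (A ω) i j' := by
      intro j' hj' i
      have : j' ≠ j := fun h => hj (h ▸ hj')
      simp [zeroCol, this]
    have hest : subspaceEstimate X V (zeroCol j (A ω)) (W ω) =
        subspaceEstimate X V (A ω) (W ω) := by
      rw [subspaceEstimate, subspaceEstimate, zeroCol_mul hj]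
    refine ⟨T, ?_, ?_⟩
    · rw [hest]
      exact hT.congr hcongr hI
    · rw [hest]
      rw [oracleScore, dominantResidual] at hsc
      rw [dominantResidual, ← augmented_congr hcongr (hT.subset hI).2, map_smul, norm_sq_sqrt_smul]
      gcongr
  · rw [hA.map_smul_euclideanCol hm j]
    -- With `(z, w)` fixed there is at most one `T`, so the section concerns one fixed projection,
    -- of trace at least `m - k`.
    by_cases hrun : ∃ T, OracleRun k z (subspaceEstimate X V z w) I (rowSupport X) q T
    · obtain ⟨T, hT⟩ := hrun
      have hD := isStarProjection_dominantProjection k (augmented z T (subspaceEstimate X V z w))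
      have htr : (m : ℝ) - k ≤
          opTrace (1 - dominantProjection m _ k (augmented z T (subspaceEstimate X V z w))) := by
        rw [opTrace_one_sub]
        exact sub_le_sub_left (opTrace_dominantProjection_le k _) _
      refine le_trans (measure_mono fun x hx => ?_)
        (stdGaussian_norm_sq_le_le hD.one_sub htr hs (τ := m * τ))
      obtain ⟨T', hT', hx⟩ := hx
      obtain rfl := hT.unique hT'
      exact hx
    · have : {x | ((z, w), x) ∈ C} = ∅ := by
        rw [Set.eq_empty_iff_forall_notMem]
        rintro x ⟨T, hT, -⟩
        exact hrun ⟨T, hT⟩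
      rw [this, measure_empty]
      exact zero_le

/-- Failure probability of the generalized MUSIC steps in fixed dimensions. -/
theorem IsGaussianSensing.measure_snr_and_not_recovers_le (hA : IsGaussianSensing A P)
    (hm : 0 < m) {W : Ω → Matrix (Fin m) (Fin N) ℝ} (hW : Measurable W) (hAW : IndepFun A W P)
    {X : Matrix (Fin n) (Fin N) ℝ} {V : Matrix (Fin m) (Fin N) ℝ → Matrix (Fin N) (Fin r) ℝ}
    (hV : Measurable V) {I : Finset (Fin n)} (hI : I ⊆ rowSupport X) {k p : ℕ}
    (hcard : (rowSupport X).card = k) (hp : I.card + p = k)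
    {S : Ω → Matrix (Fin m) (Fin r) ℝ}
    (hS : ∀ ω c, WithLp.toLp 2 ((S ω).mulVec c) ∈ columnSpan (A ω) (rowSupport X))
    {γ ε τ s t : ℝ} (hγ : γ < 1) (h0γ : 0 ≤ γ) (hτ : dampingFactor γ * ε ≤ τ)
    (hs : 0 ≤ s) (ht0 : 0 ≤ t) (ht : t < 1 / 2) :
    P {ω | SnrCondition (A ω) (S ω) (subspaceEstimate X V (A ω) (W ω)) k I γ ∧
        ¬ MusicRecovers (A ω) (subspaceEstimate X V (A ω) (W ω)) k I p (rowSupport X)} ≤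
      n * ENNReal.ofReal (Real.exp (t / (1 - 2 * t) * m - t * (m * ε))) +
      n * (p * ENNReal.ofReal (Real.exp (s * (m * τ) - s / (1 + 2 * s) * (m - k)))) := by
  -- Outside these events every column is shorter than `ε` in squared length and every outside score
  -- along the run exceeds `τ`. Neither event involves `S`.
  let B₁ : Fin n → Set Ω := fun j => {ω | ε ≤ ‖euclideanCol (A ω) j‖ ^ 2}
  let B₂ : Fin n → ℕ → Set Ω := fun j q => {ω | ∃ T,
    OracleRun k (A ω) (subspaceEstimate X V (A ω) (W ω)) I (rowSupport X) q T ∧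
      oracleScore k (A ω) (subspaceEstimate X V (A ω) (W ω)) T j ≤ τ}
  have hsub : {ω | SnrCondition (A ω) (S ω) (subspaceEstimate X V (A ω) (W ω)) k I γ ∧
      ¬ MusicRecovers (A ω) (subspaceEstimate X V (A ω) (W ω)) k I p (rowSupport X)} ⊆
      (⋃ j ∈ Finset.univ, B₁ j) ∪
        ⋃ j ∈ Finset.univ \ rowSupport X, ⋃ q ∈ Finset.range p, B₂ j q := by
    rintro ω ⟨hsnr, hnot⟩
    by_contra hω
    simp only [Set.mem_union, Set.mem_iUnion, not_or, not_exists, Finset.mem_univ, true_and,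
      Finset.mem_sdiff, Finset.mem_range, B₁, B₂, Set.mem_ofPred_eq, not_and, not_le,
      exists_prop] at hω
    refine hnot (hsnr.musicRecovers hγ h0γ hI hcard hp (hS ω) hτ (fun j _ => ?_)
      fun q hq T hT j hj => ?_)
    · exact (hω.1 j).le
    · exact hω.2 j hj q hq T hT
  refine (measure_mono hsub).trans ((measure_union_le _ _).trans (add_le_add ?_ ?_))
  · refine (measure_biUnion_finset_le _ _).trans ((Finset.sum_le_card_nsmul _ _ _
      fun j _ => hA.measure_le_norm_sq_euclideanCol hm j ht0 ht).trans ?_)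
    simp
  · refine (measure_biUnion_finset_le _ _).trans ((Finset.sum_le_card_nsmul _ _ _
      fun j hj => (measure_biUnion_finset_le _ _).trans (Finset.sum_le_card_nsmul _ _ _
      fun q _ => hA.measure_oracleScore_le hm hW hAW hV hI (Finset.mem_sdiff.1 hj).2 k q hs)).trans
        ?_)
    rw [Finset.card_range, nsmul_eq_mul, nsmul_eq_mul]
    gcongr
    exact (Finset.card_le_univ _).trans (by simp)

end FiniteDimension

/-! ### The large system limit -/

section LargeSystemLimit

/-- For `γ > 0` the square does it, `(1 - γ)² < 1 - γ`; at `γ = 0` only the cap `1 / 2` does. -/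
lemma dampingFactor_lt {γ : ℝ} (h0 : 0 ≤ γ) (h1 : γ < 1) : dampingFactor γ < 1 - γ := by
  rcases eq_or_lt_of_le h0 with rfl | h
  · exact (min_le_right _ _).trans_lt (by norm_num)
  · exact (min_le_left _ _).trans_lt (by nlinarith)

/-- Exponential tails beat the union bound when `log n = o(m n)`. -/
lemma eventually_mul_exp_le {m : ℕ → ℕ} (hm : Tendsto m atTop atTop)
    (hlog : Tendsto (fun n : ℕ => Real.log (n : ℝ) / (m n : ℝ)) atTop (𝓝 0)) {c : ℝ} (hc : 0 < c) :
    ∀ᶠ n : ℕ in atTop, (n : ℝ) * (1 + m n) * Real.exp (-(c * m n)) ≤ 1 / (n : ℝ) ^ 2 := by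
  have h1 : Tendsto (fun n => ((1 : ℝ) + m n) * Real.exp (-(c / 2 * m n))) atTop (𝓝 0) := by
    have hx : Tendsto (fun x : ℝ => (1 + x) * Real.exp (-(c / 2 * x))) atTop (𝓝 0) := by
      have ha := Real.tendsto_pow_mul_exp_neg_atTop_nhds_zero 1
      have hb : Tendsto (fun x : ℝ => c / 2 * x) atTop atTop :=
        tendsto_id.const_mul_atTop (by positivity)
      have hd := (ha.comp hb).const_mul (2 / c)
      have he := (Real.tendsto_exp_neg_atTop_nhds_zero.comp hb).add hd
      simp only [mul_zero, add_zero] at he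
      refine he.congr fun x => ?_
      simp only [Function.comp_apply, pow_one]
      field_simp
    exact hx.comp (tendsto_natCast_atTop_atTop.comp hm)
  -- Half of the decay absorbs `1 + m`. The other half is at most `n⁻³`, because `log n < c m / 6`
  -- eventually.
  filter_upwards [h1.eventually (gt_mem_nhds one_pos),
    hlog.eventually (gt_mem_nhds (by positivity : 0 < c / 6)), hm.eventually_gt_atTop 0,
    eventually_gt_atTop 0] with n hn1 hn2 hmn hn0
  have hn : (0 : ℝ) < n := by exact_mod_cast hn0
  have hm' : (0 : ℝ) < m n := by exact_mod_cast hmn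
  rw [div_lt_iff₀ hm'] at hn2
  have h2 : Real.exp (-(c / 2 * m n)) ≤ 1 / (n : ℝ) ^ 3 := by
    have h3 : Real.exp (-(3 * Real.log n)) = 1 / (n : ℝ) ^ 3 := by
      rw [Real.exp_neg, one_div, ← Real.exp_log (pow_pos hn 3), Real.log_pow]
      norm_num
    rw [← h3]
    exact Real.exp_le_exp.2 (by linarith)
  have h3 : Real.exp (-(c * m n)) =
      Real.exp (-(c / 2 * m n)) * Real.exp (-(c / 2 * m n)) := by
    rw [← Real.exp_add]; congr 1; ring
  calc (n : ℝ) * (1 + m n) * Real.exp (-(c * m n))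
      = n * (((1 : ℝ) + m n) * Real.exp (-(c / 2 * m n))) * Real.exp (-(c / 2 * m n)) := by
        rw [h3]; ring
    _ ≤ n * 1 * (1 / (n : ℝ) ^ 3) := by gcongr
    _ = 1 / (n : ℝ) ^ 2 := by field_simp

/-- Events of probability eventually at most `1 / n²` have vanishing probability and occur only
finitely often. -/
lemma tendsto_zero_and_ae_eventually_of_le {Ω : Type*} [MeasurableSpace Ω] {P : Measure Ω}
    {B : ℕ → Set Ω}
    (h : ∀ᶠ n : ℕ in atTop, P (B n) ≤ ENNReal.ofReal (1 / (n : ℝ) ^ 2)) :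
    Tendsto (fun n => P (B n)) atTop (𝓝 0) ∧ ∀ᵐ ω ∂P, ∀ᶠ n in atTop, ω ∉ B n := by
  have hsum : Summable fun n : ℕ => 1 / (n : ℝ) ^ 2 :=
    Real.summable_one_div_nat_pow.2 one_lt_two
  constructor
  · refine tendsto_of_tendsto_of_tendsto_of_le_of_le' tendsto_const_nhds ?_
      (Eventually.of_forall fun _ => zero_le) h
    simpa [Function.comp_def] using
      (ENNReal.continuous_ofReal.tendsto 0).comp hsum.tendsto_atTop_zero
  · obtain ⟨n₀, hn₀⟩ := eventually_atTop.1 h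
    -- The finitely many events without a bound are replaced by `∅` before applying Borel–Cantelli.
    have hfin : ∑' n, P (if n₀ ≤ n then B n else ∅) ≠ ⊤ := by
      refine ne_top_of_le_ne_top hsum.tsum_ofReal_ne_top (ENNReal.tsum_le_tsum fun n => ?_)
      split_ifs with hn
      · exact hn₀ n hn
      · simp
    filter_upwards [ae_eventually_notMem hfin] with ω hω
    filter_upwards [hω, eventually_ge_atTop n₀] with n h1 h2
    simpa [h2] using h1

end LargeSystemLimit

theorem mainTheorem6 {Ω : Type*} [MeasurableSpace Ω] (P : Measure Ω) [IsProbabilityMeasure P]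
    -- dimensions, as functions of the ambient dimension `n`
    (m k r l N : ℕ → ℕ) (γ : ℝ)
    (hm : Tendsto m atTop atTop)
    (hlog : Tendsto (fun n : ℕ => Real.log (n : ℝ) / (m n : ℝ)) atTop (𝓝 0))
    (hγ : Tendsto (fun n : ℕ => (k n : ℝ) / (m n : ℝ)) atTop (𝓝 γ)) (hγ1 : γ < 1)
    (hrk : ∀ n, r n ≤ k n) (hlr : ∀ n, l n ≤ r n)
    -- Gaussian sensing matrix, independent noise, unknown row-sparse signal
    (A : ∀ n, Ω → Matrix (Fin (m n)) (Fin n) ℝ) (hA : ∀ n, IsGaussianSensing (A n) P)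
    (W : ∀ n, Ω → Matrix (Fin (m n)) (Fin (N n)) ℝ) (hW : ∀ n, Measurable (W n))
    (hAW : ∀ n, IndepFun (A n) (W n) P)
    (X : ∀ n, Matrix (Fin n) (Fin (N n)) ℝ) (hX : ∀ n, (rowSupport (X n)).card = k n)
    (Y : ∀ n, Ω → Matrix (Fin (m n)) (Fin (N n)) ℝ)
    (hY : ∀ n ω, Y n ω = A n ω * X n + W n ω)
    -- signal subspace estimate `St = Y V(Y) = A (X V(Y)) + W V(Y)`, computed from the data
    (V : ∀ n, Matrix (Fin (m n)) (Fin (N n)) ℝ → Matrix (Fin (N n)) (Fin (r n)) ℝ)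
    (hV : ∀ n, Measurable (V n))
    (St : ∀ n, Ω → Matrix (Fin (m n)) (Fin (r n)) ℝ)
    (hSt : ∀ n ω, St n ω = Y n ω * V n (Y n ω))
    -- noiseless signal subspace: `R(S) = R(A X V(Y))`
    (S : ∀ n, Ω → Matrix (Fin (m n)) (Fin (r n)) ℝ)
    (hS : ∀ n ω, LinearMap.range (S n ω).mulVecLin =
      LinearMap.range (A n ω * (X n * V n (Y n ω))).mulVecLin)
    -- the known part of the support
    (I : ∀ n, Finset (Fin n)) (hI : ∀ n, I n ⊆ rowSupport (X n))
    (hIcard : ∀ n, (I n).card = k n - r n + l n) :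
    Tendsto (fun n => P {ω | SnrCondition (A n ω) (S n ω) (St n ω) (k n) (I n) γ ∧
        ¬ MusicRecovers (A n ω) (St n ω) (k n) (I n) (r n - l n) (rowSupport (X n))})
      atTop (𝓝 0) ∧
    (∀ᵐ ω ∂P, ∀ᶠ n in atTop, SnrCondition (A n ω) (S n ω) (St n ω) (k n) (I n) γ →
      MusicRecovers (A n ω) (St n ω) (k n) (I n) (r n - l n) (rowSupport (X n))) := by
  have h0γ : 0 ≤ γ := ge_of_tendsto' hγ fun n => by positivity
  have hdf := dampingFactor_lt h0γ hγ1
  have hdf0 : 0 ≤ dampingFactor γ := le_min (sq_nonneg _) (by norm_num)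
  have hdf1 : dampingFactor γ ≤ 1 / 2 := min_le_right _ _
  -- Half the gap: `τ = d + η = 1 - γ - η` lies midway between the two score levels. Next, `t`
  -- solves `1 / (1 - 2t) = 1 + η / 2`, so at length `ε = 1 + η` the upper tail exponent is `-t (η /
  -- 2) m`.
  obtain ⟨η, hη⟩ : ∃ η, η = (1 - γ - dampingFactor γ) / 2 := ⟨_, rfl⟩
  obtain ⟨t, ht⟩ : ∃ t, t = (1 - 1 / (1 + η / 2)) / 2 := ⟨_, rfl⟩
  have hη0 : 0 < η := by linarith
  have hinv : 1 / (1 + η / 2) < 1 := by rw [div_lt_one (by linarith)]; linarith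
  have hinv0 : 0 < 1 / (1 + η / 2) := by positivity
  have ht0 : 0 < t := by linarith
  have ht1 : t < 1 / 2 := by linarith
  have ht2 : t / (1 - 2 * t) = t * (1 + η / 2) := by
    have : 1 - 2 * t = 1 / (1 + η / 2) := by linarith
    rw [this, div_div_eq_mul_div, div_one]
  have hbound : ∀ᶠ n : ℕ in atTop,
      P {ω | SnrCondition (A n ω) (S n ω) (St n ω) (k n) (I n) γ ∧
        ¬ MusicRecovers (A n ω) (St n ω) (k n) (I n) (r n - l n) (rowSupport (X n))} ≤
      ENNReal.ofReal (1 / (n : ℝ) ^ 2) := by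
    have hc : 0 < min (t * (η / 2)) (η / 8 * (η / 4)) := by positivity
    filter_upwards [eventually_mul_exp_le hm hlog hc, hm.eventually_gt_atTop 0,
      hγ.eventually (gt_mem_nhds (by linarith : γ < γ + η / 2))] with n hn hmn hkm
    have hm' : (0 : ℝ) < m n := by exact_mod_cast hmn
    rw [div_lt_iff₀ hm'] at hkm
    have hSt' : ∀ ω, St n ω = subspaceEstimate (X n) (V n) (A n ω) (W n ω) := fun ω => by
      rw [hSt, hY, subspaceEstimate]
    simp_rw [hSt']
    refine ((hA n).measure_snr_and_not_recovers_le hmn (hW n) (hAW n) (hV n) (hI n) (hX n)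
      (p := r n - l n) (by have := hIcard n; have := hrk n; have := hlr n; omega)
      (fun ω c => toLp_mulVec_mem_columnSpan_rowSupport (X n) _ (hS n ω) c) hγ1 h0γ
      (ε := 1 + η) (τ := dampingFactor γ + η) (s := η / 8) (by nlinarith) (by positivity)
      ht0.le ht1).trans ?_
    have e1 : Real.exp (t / (1 - 2 * t) * m n - t * (m n * (1 + η))) ≤
        Real.exp (-(min (t * (η / 2)) (η / 8 * (η / 4)) * m n)) := by
      refine Real.exp_le_exp.2 ?_
      have := mul_le_mul_of_nonneg_right (min_le_left (t * (η / 2)) (η / 8 * (η / 4))) hm'.le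
      rw [ht2]
      linarith
    have e2 : Real.exp (η / 8 * (m n * (dampingFactor γ + η)) -
        η / 8 / (1 + 2 * (η / 8)) * (m n - k n)) ≤
        Real.exp (-(min (t * (η / 2)) (η / 8 * (η / 4)) * m n)) := by
      refine Real.exp_le_exp.2 ?_
      have h1 := mul_le_mul_of_nonneg_right (min_le_right (t * (η / 2)) (η / 8 * (η / 4))) hm'.le
      -- As `k < (γ + η / 2) m`, one has `m - k > (d + 3η / 2) m`. Dividing by `1 + 2s = 1 + η / 4`
      -- loses at most `(η / 4) m`, since `d + 5η / 4 ≤ 1`; a margin of `(η / 4) m` over `τ m`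
      -- remains.
      have h2 : (dampingFactor γ + η + η / 4) * m n ≤ (m n - k n) / (1 + 2 * (η / 8)) := by
        rw [le_div_iff₀ (by positivity)]
        have h3 : (dampingFactor γ + η + η / 4) * (1 + 2 * (η / 8)) ≤ 1 - (γ + η / 2) := by
          nlinarith
        nlinarith
      have h4 := mul_le_mul_of_nonneg_left h2 (by positivity : 0 ≤ η / 8)
      have h5 : η / 8 / (1 + 2 * (η / 8)) * (m n - k n) =
        η / 8 * ((m n - k n) / (1 + 2 * (η / 8))) := by ring
      rw [h5]
      linarith
    -- The number of steps is at most `k ≤ m`, so the union bound costs at most the factor `n (1 +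
    -- m)`.
    have hpm : ((r n - l n : ℕ) : ℝ) ≤ m n := by
      have h1 : ((r n - l n : ℕ) : ℝ) ≤ k n := by
        have := hrk n
        exact_mod_cast (by omega : r n - l n ≤ k n)
      nlinarith
    set x := Real.exp (-(min (t * (η / 2)) (η / 8 * (η / 4)) * m n)) with hx
    have hx0 : 0 ≤ x := (Real.exp_pos _).le
    calc _ ≤ (n : ENNReal) * ENNReal.ofReal x +
          n * ((r n - l n : ℕ) * ENNReal.ofReal x) := by gcongr
      _ = ENNReal.ofReal (n * x + n * ((r n - l n : ℕ) * x)) := by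
          rw [ENNReal.ofReal_add (by positivity) (by positivity),
            ENNReal.ofReal_mul (by positivity), ENNReal.ofReal_mul (by positivity),
            ENNReal.ofReal_mul (by positivity), ENNReal.ofReal_natCast, ENNReal.ofReal_natCast]
      _ ≤ ENNReal.ofReal (1 / (n : ℝ) ^ 2) := by
          refine ENNReal.ofReal_le_ofReal (le_trans ?_ hn)
          have h1 : (n : ℝ) * ((r n - l n : ℕ) * x) ≤ n * (m n * x) := by gcongr
          linarith
  obtain ⟨h1, h2⟩ := tendsto_zero_and_ae_eventually_of_le hbound
  refine ⟨h1, h2.mono fun ω hω => hω.mono fun n hn hsnr => ?_⟩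
  by_contra hnot
  exact hn ⟨hsnr, hnot⟩
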